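/- Let $p$ be a prime number and let $h'$ be an integer with $1\le h'\le 10$. Fix an embedding $\overline{\mathbb{Q}}\hookrightarrow\overline{\mathbb{Q}}_p$, and for a power $q=p^a$ ($a\ge 1$) let $\nu_q$ be the $p$-adic valuation on $\overline{\mathbb{Q}}_p$ normalized by $\nu_q(q)=1$. For a polynomial $Q(T)=\prod_j(1-\beta_jT)\in\mathbb{Q}[T]$ with $\beta_j\in\overline{\mathbb{Q}}$, put $Q_{<0}(T)=\prod_{\nu_q(\beta_j)<0}(1-\beta_jT)\in\mathbb{Q}_p[T]$. Then there exist a power $q=p^a$ of $p$ with $a\ge 1$, a polynomial $$L(T)=\prod_{i=1}^{20}(1-\gamma_iT)\in 1+T\mathbb{Q}[T]\qquad(\gamma_i\in\overline{\mathbb{Q}})$$ of degree $20$, an integer $e\ge 1$ and an irreducible polynomial $Q(T)\in\mathbb{Q}[T]$ with $Q(0)=1$ such that: - all complex roots of $L(T)$ have absolute value one; - no root of $L(T)$ is a root of unity; - $L(T)\in\mathbb{Z}_\ell[T]$ for all prime numbers $\ell\ne p$; - the roots $\alpha_1,\dots,\alpha_{20}\in\overline{\mathbb{Q}}$ of $L(T)$,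 counted with multiplicity, can be ordered so that $\nu_q(\alpha_i)=-1/h'$ for $1\le i\le h'$, $\nu_q(\alpha_i)=0$ for $h'+1\le i\le 20-h'$, and $\nu_q(\alpha_i)=1/h'$ for $20-h'+1\le i\le 20$; - $L(T)=Q(T)^e$; - $Q_{<0}(T)$ is an irreducible polynomial in $\mathbb{Q}_p[T]$; - the discriminant $\mathrm{disc}(\mathbb{Q}(\gamma_1))$ of the number field $\mathbb{Q}(\gamma_1)$ is a square, or $e$ is even (or both). -/

import Mathlib

open Polynomial IntermediateField

noncomputable section

/-- The field of algebraic numbers. -/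
abbrev Qbar : Type := AlgebraicClosure ℚ

instance isAlgClosure_Qbar : IsAlgClosure ℚ Qbar where
  isAlgClosed := AlgebraicClosure.isAlgClosed ℚ
  isAlgebraic := AlgebraicClosure.isAlgebraic ℚ

instance isAlgebraic_Qbar : Algebra.IsAlgebraic ℚ Qbar := IsAlgClosure.isAlgebraic

/-- The `p`-adic valuation on an algebraic closure of `ℚ_p`, normalized by `ν_q(q) = 1`
(for `q` a power of `p` with positive exponent). `PadicAlgCl p` is Mathlib's algebraic closure
of `ℚ_[p]`, with the unique norm extending the `p`-adic norm. -/
def nu (p : ℕ) [Fact p.Prime] (q : ℕ) (x : PadicAlgCl p) : WithTop ℝ :=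
  open Classical in if x = 0 then ⊤ else ((-Real.logb (q : ℝ) ‖x‖ : ℝ) : WithTop ℝ)

/-- The multiset of the `β_j` in the factorization `Q(T) = ∏_j (1 - β_j T)` of a polynomial with
constant term `1`, i.e. the inverses of the roots with multiplicity. -/
def inverseRoots (Q : ℚ[X]) : Multiset Qbar :=
  (Q.aroots Qbar).map fun r => r⁻¹

open Classical in
/-- `Q_{<0}(T) = ∏_{ν_q(β_j) < 0} (1 - β_j T)`, as a polynomial over the algebraic closure
of `ℚ_p`. -/
def negPart (p : ℕ) [Fact p.Prime] (ι : Qbar →+* PadicAlgCl p) (q : ℕ) (Q : ℚ[X]) :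
    (PadicAlgCl p)[X] :=
  (((inverseRoots Q).filter fun β => nu p q (ι β) < 0).map fun β => 1 - C (ι β) * X).prod

/-- The conditions on a polynomial `L(T) ∈ 1 + T ℚ[T]` of degree `2m`, for the power `q` of `p`,
with the integers `h` and `e` that occur in them made explicit. -/
structure SatisfiesCondition (p : ℕ) [Fact p.Prime] (ι : Qbar →+* PadicAlgCl p)
    (q m h e : ℕ) (L : ℚ[X]) : Prop where
  q_eq_pow : ∃ a : ℕ, 1 ≤ a ∧ q = p ^ a
  coeff_zero : L.coeff 0 = 1
  natDegree_eq : L.natDegree = 2 * m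
  norm_root : ∀ z : ℂ, aeval z L = 0 → ‖z‖ = 1
  not_rootOfUnity : ∀ z : ℂ, aeval z L = 0 → ∀ n : ℕ, 1 ≤ n → z ^ n ≠ 1
  integral : ∀ (l : ℕ) [Fact l.Prime], l ≠ p →
    L.map (algebraMap ℚ ℚ_[l]) ∈ Polynomial.lifts (algebraMap ℤ_[l] ℚ_[l])
  one_le_h : 1 ≤ h
  h_le_m : h ≤ m
  slopes : ∃ α : Fin (2 * m) → Qbar, L.aroots Qbar = Finset.univ.val.map α ∧
    ∀ i : Fin (2 * m),
      ((i : ℕ) < h → nu p q (ι (α i)) = ((-1 / h : ℝ) : WithTop ℝ)) ∧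
      (h ≤ (i : ℕ) → (i : ℕ) < 2 * m - h → nu p q (ι (α i)) = 0) ∧
      (2 * m - h ≤ (i : ℕ) → nu p q (ι (α i)) = ((1 / h : ℝ) : WithTop ℝ))
  one_le_e : 1 ≤ e
  power : ∃ Q : ℚ[X], Irreducible Q ∧ Q.coeff 0 = 1 ∧ L = Q ^ e ∧
    ∃ P : ℚ_[p][X], P.map (algebraMap ℚ_[p] (PadicAlgCl p)) = negPart p ι q Q ∧ Irreducible P

instance numberField_adjoin_simple (x : Qbar) : NumberField ℚ⟮x⟯ where
  to_charZero := inferInstance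
  to_finiteDimensional :=
    IntermediateField.adjoin.finiteDimensional (Algebra.IsIntegral.isIntegral x)

end

/-! Take `e = 1` and `Q = L`, with `L = T^20 - T^10 + 1 + w T^10 G(T + 1/T)`, where `w` has `p`-adic
absolute value `p^a`, with a denominator dividing `p^a`, and `G` is monic over `ℤ` of degree `10 -
h`. This `L` is a small real, but large `p`-adic, perturbation of a product of cyclotomic
polynomials. `IsAdmissible` collects what is needed of `w` and `G`.

Complex roots: at `e^(iθ)`, `L` equals `e^(10iθ)` times `2 cos 10θ - 1 + w G(2 cos θ)`. Since `|w G|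
< 1` on `[-2, 2]`, this real factor changes sign between consecutive multiples of `π/10`, so all
twenty roots are simple and on the unit circle.

`p`-adic roots: if `|t| > 1`, the two terms balance only for `|t|^h = p^a`. There are `h` such
roots, `h` inverse ones, and the rest are units. As `h` and `a` are coprime, the `h` large roots are
conjugate over `ℚ_p`, and so are the `h` small ones.

Irreducibility over `ℚ`: the large roots share one minimal polynomial. A further factor would have a
root `β` with all `p`-adic conjugates of norm at most one. The norm of `β^20 - β^10 + 1` would then
be an integer, and nonzero of absolute value below one because `β^20 - β^10 + 1` is minus the
perturbation at `β`; this is impossible (`exists_conjugate_one_lt`). A large `p`-adic root also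
rules out roots of unity.

Discriminant: since `L` is self-reciprocal, `L'(γ) = γ^8 (γ^2 - 1) y` with `y` fixed by `γ ↦ 1/γ`.
Up to squares the discriminant is thus `L(1) L(-1) = (1 + w G(2)) (1 + w G(-2))`, which the choice
of `w` and `G` makes a square. -/

noncomputable section

/-! ### The self-reciprocal family -/

/-- The reciprocal polynomial `T ^ 10 * G (T + T⁻¹)`, for `G` of degree less than `10`. -/
def reciprocalLift (G : ℤ[X]) : ℤ[X] :=
  ∑ j ∈ Finset.range 10, C (G.coeff j) * X ^ (10 - j) * (X ^ 2 + 1) ^ j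

theorem natDegree_reciprocalLift_le (G : ℤ[X]) : (reciprocalLift G).natDegree ≤ 19 := by
  refine natDegree_sum_le_of_forall_le _ _ fun j hj => ?_
  have hj' := Finset.mem_range.1 hj
  have : (C (G.coeff j) * X ^ (10 - j) * (X ^ 2 + 1) ^ j : ℤ[X]).natDegree
      ≤ 0 + (10 - j) + j * 2 := by
    compute_degree
    omega
  omega

theorem eval₂_reciprocalLift {K : Type*} [Field K] {G : ℤ[X]} (hG : G.natDegree < 10) {z : K}
    (hz : z ≠ 0) : (reciprocalLift G).eval₂ (Int.castRingHom K) z =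
      z ^ 10 * G.eval₂ (Int.castRingHom K) (z + z⁻¹) := by
  rw [reciprocalLift, eval₂_finsetSum, eval₂_eq_sum_range' _ hG, Finset.mul_sum]
  refine Finset.sum_congr rfl fun j hj => ?_
  have hj' := Finset.mem_range.1 hj
  have h1 : z ^ 2 + 1 = z * (z + z⁻¹) := by field_simp
  have h2 : z ^ 10 = z ^ (10 - j) * z ^ j := by rw [← pow_add]; congr 1; omega
  simp only [eval₂_mul, eval₂_pow, eval₂_add, eval₂_X, eval₂_one, eval₂_C, h1, mul_pow, h2]
  ring

theorem coeff_zero_reciprocalLift (G : ℤ[X]) : (reciprocalLift G).coeff 0 = 0 := by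
  rw [coeff_zero_eq_eval_zero, reciprocalLift, eval_finsetSum]
  refine Finset.sum_eq_zero fun j hj => ?_
  have hj' := Finset.mem_range.1 hj
  have : 10 - j ≠ 0 := by omega
  simp [this]

/-- The perturbation of the polynomial `T ^ 20 - T ^ 10 + 1` by `w T ^ 10 G (T + T⁻¹)`. -/
def perturbedCyclotomic (w : ℚ) (G : ℤ[X]) : ℚ[X] :=
  X ^ 20 - X ^ 10 + 1 + C w * (reciprocalLift G).map (Int.castRingHom ℚ)

section basic

variable (w : ℚ) (G : ℤ[X])

theorem degree_perturbedCyclotomic_sub_lt :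
    (-X ^ 10 + 1 + C w * (reciprocalLift G).map (Int.castRingHom ℚ)).degree <
      ((20 : ℕ) : WithBot ℕ) := by
  suffices h : (-X ^ 10 + 1 + C w * (reciprocalLift G).map (Int.castRingHom ℚ)).natDegree ≤ 19 from
    (natDegree_le_iff_degree_le.1 h).trans_lt (by norm_num)
  have h := natDegree_reciprocalLift_le G
  have h2 : (C w * (reciprocalLift G).map (Int.castRingHom ℚ)).natDegree ≤ 19 :=
    (natDegree_C_mul_le _ _).trans (natDegree_map_le.trans h)
  refine (natDegree_add_le _ _).trans (max_le ?_ h2)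
  compute_degree
  norm_num

theorem perturbedCyclotomic_eq : perturbedCyclotomic w G =
    X ^ 20 + (-X ^ 10 + 1 + C w * (reciprocalLift G).map (Int.castRingHom ℚ)) := by
  rw [perturbedCyclotomic]; ring

theorem monic_perturbedCyclotomic : (perturbedCyclotomic w G).Monic := by
  rw [perturbedCyclotomic_eq]
  exact monic_X_pow_add (degree_perturbedCyclotomic_sub_lt w G)

theorem natDegree_perturbedCyclotomic : (perturbedCyclotomic w G).natDegree = 20 := by
  refine natDegree_eq_of_degree_eq_some ?_
  rw [perturbedCyclotomic_eq, degree_add_eq_left_of_degree_lt, degree_X_pow]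
  rw [degree_X_pow]
  exact degree_perturbedCyclotomic_sub_lt w G

theorem coeff_zero_perturbedCyclotomic : (perturbedCyclotomic w G).coeff 0 = 1 := by
  simp [perturbedCyclotomic, coeff_zero_reciprocalLift]

variable {w G}

theorem aeval_perturbedCyclotomic {K : Type*} [Field K] [Algebra ℚ K] (hG : G.natDegree < 10)
    {z : K} (hz : z ≠ 0) : aeval z (perturbedCyclotomic w G) =
      z ^ 10 * (z ^ 10 + z⁻¹ ^ 10 - 1 +
        algebraMap ℚ K w * G.eval₂ (Int.castRingHom K) (z + z⁻¹)) := by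
  have h : aeval z ((reciprocalLift G).map (Int.castRingHom ℚ)) =
      (reciprocalLift G).eval₂ (Int.castRingHom K) z := by
    rw [aeval_def, eval₂_map, RingHom.ext_int ((algebraMap ℚ K).comp _) (Int.castRingHom K)]
  simp only [perturbedCyclotomic, map_add, map_sub, map_mul, map_pow, aeval_X, map_one, aeval_C, h,
    eval₂_reciprocalLift hG hz]
  field_simp
  ring

theorem aeval_zero_perturbedCyclotomic {K : Type*} [Field K] [Algebra ℚ K] :
    aeval (0 : K) (perturbedCyclotomic w G) = 1 := by
  rw [← coeff_zero_eq_aeval_zero', coeff_zero_perturbedCyclotomic, map_one]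

theorem ne_zero_of_aeval_perturbedCyclotomic {K : Type*} [Field K] [Algebra ℚ K] {z : K}
    (hz : aeval z (perturbedCyclotomic w G) = 0) : z ≠ 0 := by
  rintro rfl
  rw [aeval_zero_perturbedCyclotomic] at hz
  exact one_ne_zero hz

theorem aeval_inv_perturbedCyclotomic {K : Type*} [Field K] [Algebra ℚ K] (hG : G.natDegree < 10)
    {z : K} (hz : z ≠ 0) : aeval z⁻¹ (perturbedCyclotomic w G) * z ^ 20 =
      aeval z (perturbedCyclotomic w G) := by
  rw [aeval_perturbedCyclotomic hG hz, aeval_perturbedCyclotomic hG (inv_ne_zero hz), inv_inv,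
    add_comm z⁻¹ z]
  field_simp
  ring

theorem reflect_perturbedCyclotomic (hG : G.natDegree < 10) :
    (perturbedCyclotomic w G).reflect 20 = perturbedCyclotomic w G := by
  -- The factor `X` makes both sides vanish at `0`, where the functional equation under inversion
  -- says nothing.
  have key : X * (perturbedCyclotomic w G).reflect 20 = X * perturbedCyclotomic w G := by
    refine Polynomial.funext fun z => ?_
    rcases eq_or_ne z 0 with rfl | hz
    · simp
    · have := invertibleOfNonzero (inv_ne_zero hz)
      have h1 := eval₂_reflect_mul_pow (RingHom.id ℚ) z⁻¹ 20 (perturbedCyclotomic w G)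
        (natDegree_perturbedCyclotomic w G).le
      have h2 := aeval_inv_perturbedCyclotomic (w := w) hG hz
      simp only [invOf_eq_inv, inv_inv, eval₂_id] at h1
      simp only [coe_aeval_eq_eval, ← h1] at h2
      rw [eval_mul, eval_mul, ← h2]
      field_simp
  exact mul_left_cancel₀ X_ne_zero key

end basic

/-! ### Ultrametric estimates and conjugates over `ℚ_p` -/

theorem norm_multiset_prod {K : Type*} [NormedField K] (M : Multiset K) :
    ‖M.prod‖ = (M.map fun x => ‖x‖).prod :=
  map_multiset_prod (normHom : K →*₀ ℝ) M

theorem norm_eval₂_of_monic_of_one_lt_norm {K : Type*} [NormedField K] [IsUltrametricDist K]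
    {G : ℤ[X]} (hG : G.Monic) {x : K} (hx : 1 < ‖x‖) :
    ‖G.eval₂ (Int.castRingHom K) x‖ = ‖x‖ ^ G.natDegree := by
  rw [eval₂_eq_sum_range, Finset.sum_range_succ, coeff_natDegree, hG.leadingCoeff, map_one, one_mul]
  have hlt : ‖∑ i ∈ Finset.range G.natDegree, Int.castRingHom K (G.coeff i) * x ^ i‖ <
      ‖x ^ G.natDegree‖ := by
    rw [norm_pow]
    rcases Nat.eq_zero_or_pos G.natDegree with h0 | h0
    · simp [h0]
    · refine lt_of_le_of_lt (b := ‖x‖ ^ (G.natDegree - 1)) ?_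
        (pow_lt_pow_right₀ hx (by omega))
      refine IsUltrametricDist.norm_sum_le_of_forall_le_of_nonneg (by positivity) fun i hi => ?_
      have hi' := Finset.mem_range.1 hi
      rw [norm_mul, norm_pow]
      calc _ ≤ 1 * ‖x‖ ^ i := by
            gcongr
            exact IsUltrametricDist.norm_intCast_le_one K _
        _ ≤ _ := by
            rw [one_mul]
            exact pow_le_pow_right₀ hx.le (by omega)
  rw [IsUltrametricDist.norm_add_eq_max_of_norm_ne_norm hlt.ne, max_eq_right hlt.le, norm_pow]

theorem norm_add_inv_of_one_lt_norm {K : Type*} [NormedField K] [IsUltrametricDist K] {x : K}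
    (hx : 1 < ‖x‖) : ‖x + x⁻¹‖ = ‖x‖ := by
  have hlt : ‖x⁻¹‖ < ‖x‖ := by
    rw [norm_inv]
    exact (inv_lt_one_of_one_lt₀ hx).trans hx
  rw [IsUltrametricDist.norm_add_eq_max_of_norm_ne_norm hlt.ne', max_eq_left hlt.le]

theorem norm_pow_ten_add_of_one_lt_norm {K : Type*} [NormedField K] [IsUltrametricDist K] {x : K}
    (hx : 1 < ‖x‖) : ‖x ^ 10 + x⁻¹ ^ 10 - 1‖ = ‖x‖ ^ 10 := by
  have hlt : ‖x⁻¹ ^ 10 - 1‖ < ‖x ^ 10‖ := by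
    rw [norm_pow x]
    refine lt_of_le_of_lt ?_ (one_lt_pow₀ hx (n := 10) (by norm_num))
    rw [sub_eq_add_neg]
    refine (IsUltrametricDist.norm_add_le_max _ _).trans (max_le ?_ (by simp))
    rw [norm_pow, norm_inv]
    exact pow_le_one₀ (by positivity) (inv_le_one_of_one_le₀ hx.le)
  rw [add_sub_assoc, IsUltrametricDist.norm_add_eq_max_of_norm_ne_norm hlt.ne', max_eq_left hlt.le,
    norm_pow]

section padic

variable {p : ℕ} [Fact p.Prime]

/-- The norm is the spectral norm, which depends only on the minimal polynomial. -/
theorem norm_eq_of_minpoly_eq {x y : PadicAlgCl p} (h : minpoly ℚ_[p] x = minpoly ℚ_[p] y) :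
    ‖x‖ = ‖y‖ := by
  rw [← PadicAlgCl.spectralNorm_eq, ← PadicAlgCl.spectralNorm_eq, spectralNorm, spectralNorm, h]

theorem dvd_of_pow_eq_zpow {c : ℝ} {h d : ℕ} {e k : ℤ} (hh : c ^ h = (p : ℝ) ^ e)
    (hcop : IsCoprime (h : ℤ) e) (hd : c ^ d = (p : ℝ) ^ k) : h ∣ d := by
  have hp : 1 < (p : ℝ) := by exact_mod_cast (Fact.out : p.Prime).one_lt
  have h1 : (p : ℝ) ^ (k * h) = (p : ℝ) ^ (e * d) := by
    rw [zpow_mul, zpow_mul, ← hd, ← hh, zpow_natCast, zpow_natCast, ← pow_mul, ← pow_mul, mul_comm]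
  have h2 : k * h = e * d := zpow_right_injective₀ (by linarith) hp.ne' h1
  exact Int.natCast_dvd_natCast.1 (hcop.dvd_of_dvd_mul_left ⟨k, by linarith⟩)

-- All conjugates of `r` have norm `‖r‖`, so the constant term of its minimal polynomial, of degree
-- `d`, has norm `‖r‖^d`. This is an integral power of `p`, and coprimality of `h` and `e` forces `h
-- ∣ d`. With at most `h` roots of that norm available, the conjugates exhaust them.
open Classical in
theorem aroots_minpoly_eq_filter_norm {f : ℚ_[p][X]} (hf : f ≠ 0) {h : ℕ} {e : ℤ}
    (hcop : IsCoprime (h : ℤ) e) {r : PadicAlgCl p} (hr : aeval r f = 0)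
    (hrn : ‖r‖ ^ h = (p : ℝ) ^ e) (hr0 : r ≠ 0)
    (hcard : ((f.aroots (PadicAlgCl p)).filter fun s => ‖s‖ = ‖r‖).card ≤ h) :
    (minpoly ℚ_[p] r).aroots (PadicAlgCl p) =
      (f.aroots (PadicAlgCl p)).filter fun s => ‖s‖ = ‖r‖ := by
  have hint : IsIntegral ℚ_[p] r := Algebra.IsIntegral.isIntegral r
  set m := minpoly ℚ_[p] r with hm
  have hnorm : ∀ s ∈ m.aroots (PadicAlgCl p), ‖s‖ = ‖r‖ := by
    intro s hs
    refine norm_eq_of_minpoly_eq ?_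
    exact (minpoly.eq_of_irreducible_of_monic (minpoly.irreducible hint)
      (mem_aroots.1 hs).2 (minpoly.monic hint)).symm
  have hle : m.aroots (PadicAlgCl p) ≤ (f.aroots (PadicAlgCl p)).filter fun s => ‖s‖ = ‖r‖ := by
    refine Multiset.le_filter.2 ⟨?_, hnorm⟩
    refine roots.le_of_dvd ?_ ?_
    · exact Polynomial.map_ne_zero hf
    · exact Polynomial.map_dvd _ (minpoly.dvd _ _ hr)
  have hdeg : (m.aroots (PadicAlgCl p)).card = m.natDegree :=
    IsAlgClosed.card_aroots_eq_natDegree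
  have hc : ‖m.coeff 0‖ = ‖r‖ ^ m.natDegree := by
    have h1 := (IsAlgClosed.splits
      (m.map (algebraMap ℚ_[p] (PadicAlgCl p)))).coeff_zero_eq_prod_roots_of_monic
      ((minpoly.monic hint).map _)
    rw [← norm_algebraMap' (PadicAlgCl p), ← coeff_map, h1, norm_mul, norm_pow, norm_neg, norm_one,
      one_pow, one_mul, norm_multiset_prod, Multiset.map_congr rfl hnorm, Multiset.map_const',
      Multiset.prod_replicate, hdeg]
  have hc0 : m.coeff 0 ≠ 0 := minpoly.coeff_zero_ne_zero hint hr0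
  obtain ⟨k, hk⟩ := Padic.padicNormE.image hc0
  push_cast at hk
  have hdvd : h ∣ m.natDegree :=
    dvd_of_pow_eq_zpow hrn hcop (hc.symm.trans hk)
  refine Multiset.eq_of_le_of_card_le hle ?_
  rw [hdeg]
  exact hcard.trans (Nat.le_of_dvd (minpoly.natDegree_pos hint) hdvd)

end padic

/-! ### Norms and number of the `p`-adic roots -/

/-- The conditions on `w` and `G` under which `perturbedCyclotomic w G` has `h` roots of
`p`-adic valuation `-a / h`, all complex roots on the unit circle and square discriminant. -/
structure IsAdmissible (p h a : ℕ) [Fact p.Prime] (w : ℚ) (G : ℤ[X]) : Prop where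
  monic : G.Monic
  natDegree_add : G.natDegree + h = 10
  one_le_h : 1 ≤ h
  one_le_a : 1 ≤ a
  coprime : h.Coprime a
  norm_w : ‖(w : ℚ_[p])‖ = (p : ℝ) ^ a
  denominator : ∃ u : ℤ, w * (p : ℚ) ^ a = u
  bound : ∀ x : ℝ, |x| ≤ 2 → |(w : ℝ) * G.eval₂ (Int.castRingHom ℝ) x| < 1
  no_common_root : ∀ z : ℂ, z ≠ 0 → G.eval₂ (Int.castRingHom ℂ) (z + z⁻¹) = 0 →
    z ^ 20 - z ^ 10 + 1 ≠ 0
  isSquare : IsSquare ((1 + w * G.eval₂ (Int.castRingHom ℚ) 2) *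
    (1 + w * G.eval₂ (Int.castRingHom ℚ) (-2)))

namespace IsAdmissible

variable {p h a : ℕ} [Fact p.Prime] {w : ℚ} {G : ℤ[X]}

theorem natDegree_lt (H : IsAdmissible p h a w G) : G.natDegree < 10 := by
  have := H.natDegree_add
  have := H.one_le_h
  omega

theorem norm_algebraMap_w (H : IsAdmissible p h a w G)
    : ‖algebraMap ℚ (PadicAlgCl p) w‖ = (p : ℝ) ^ a := by
  rw [IsScalarTower.algebraMap_apply ℚ ℚ_[p] (PadicAlgCl p), norm_algebraMap', eq_ratCast, H.norm_w]

theorem one_lt_pow (H : IsAdmissible p h a w G) : 1 < (p : ℝ) ^ a :=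
  one_lt_pow₀ (by exact_mod_cast (Fact.out : p.Prime).one_lt) (by have := H.one_le_a; omega)

theorem norm_perturbation (H : IsAdmissible p h a w G) {t : PadicAlgCl p} (ht : 1 < ‖t‖) :
    ‖algebraMap ℚ (PadicAlgCl p) w * G.eval₂ (Int.castRingHom (PadicAlgCl p)) (t + t⁻¹)‖ =
      (p : ℝ) ^ a * ‖t‖ ^ G.natDegree := by
  have h1 := norm_add_inv_of_one_lt_norm ht
  rw [norm_mul, H.norm_algebraMap_w, norm_eval₂_of_monic_of_one_lt_norm H.monic (by rwa [h1]), h1]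

theorem norm_pow_of_root (H : IsAdmissible p h a w G) {t : PadicAlgCl p} (ht : 1 < ‖t‖)
    (hroot : aeval t (perturbedCyclotomic w G) = 0) : ‖t‖ ^ h = (p : ℝ) ^ a := by
  have ht0 : t ≠ 0 := norm_pos_iff.1 (one_pos.trans ht)
  rw [aeval_perturbedCyclotomic H.natDegree_lt ht0] at hroot
  have h1 := (mul_eq_zero.1 hroot).resolve_left (pow_ne_zero _ ht0)
  have h2 := congrArg norm (eq_neg_of_add_eq_zero_left h1)
  rw [norm_neg, norm_pow_ten_add_of_one_lt_norm ht, H.norm_perturbation ht, ← H.natDegree_add,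
    pow_add, mul_comm] at h2
  exact mul_right_cancel₀ (pow_ne_zero _ (norm_ne_zero_iff.2 ht0)) h2

theorem norm_pow_of_root_of_norm_lt_one (H : IsAdmissible p h a w G)
    {t : PadicAlgCl p} (ht : ‖t‖ < 1)
    (hroot : aeval t (perturbedCyclotomic w G) = 0) : ‖t‖⁻¹ ^ h = (p : ℝ) ^ a := by
  have ht0 : t ≠ 0 := ne_zero_of_aeval_perturbedCyclotomic hroot
  rw [← norm_inv]
  refine H.norm_pow_of_root ?_ ?_
  · rw [norm_inv]
    exact (one_lt_inv₀ (norm_pos_iff.2 ht0)).2 ht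
  · rw [← aeval_inv_perturbedCyclotomic H.natDegree_lt ht0] at hroot
    exact (mul_eq_zero.1 hroot).resolve_right (pow_ne_zero _ ht0)

theorem norm_aeval_of_norm_pow_lt (H : IsAdmissible p h a w G)
    {t : PadicAlgCl p} (ht : 1 < ‖t‖) (ht' : ‖t‖ ^ h < (p : ℝ) ^ a) :
    ‖aeval t (perturbedCyclotomic w G)‖ = (p : ℝ) ^ a * ‖t‖ ^ (10 + G.natDegree) := by
  have ht0 : t ≠ 0 := norm_pos_iff.1 (one_pos.trans ht)
  have hlt : ‖t ^ 10 + t⁻¹ ^ 10 - 1‖ <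
      ‖algebraMap ℚ (PadicAlgCl p) w * G.eval₂ (Int.castRingHom (PadicAlgCl p)) (t + t⁻¹)‖ := by
    rw [norm_pow_ten_add_of_one_lt_norm ht, H.norm_perturbation ht, ← H.natDegree_add, pow_add,
      mul_comm]
    gcongr
  rw [aeval_perturbedCyclotomic H.natDegree_lt ht0, norm_mul,
    IsUltrametricDist.norm_add_eq_max_of_norm_ne_norm hlt.ne, max_eq_right hlt.le,
    H.norm_perturbation ht, norm_pow, pow_add]
  ring

/-- Supplies a test point whose norm lies strictly between `1` and the norm `‖t‖^2` of the large
roots. -/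
theorem exists_norm_pow (H : IsAdmissible p h a w G)
    : ∃ t : PadicAlgCl p, 1 < ‖t‖ ∧ (‖t‖ ^ 2) ^ h = (p : ℝ) ^ a := by
  have hh := H.one_le_h
  obtain ⟨t, ht⟩ := IsAlgClosed.exists_pow_nat_eq (algebraMap ℚ (PadicAlgCl p) w)
    (n := 2 * h) (by omega)
  have h1 : (‖t‖ ^ 2) ^ h = (p : ℝ) ^ a := by
    rw [← pow_mul, ← norm_pow, ht, H.norm_algebraMap_w]
  refine ⟨t, ?_, h1⟩
  by_contra! hle
  have : (‖t‖ ^ 2) ^ h ≤ 1 := pow_le_one₀ (by positivity) (pow_le_one₀ (by positivity) hle)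
  linarith [H.one_lt_pow]

theorem norm_eq_of_one_lt (H : IsAdmissible p h a w G)
    {s : ℝ} (hs : 1 < s) (hsp : (s ^ 2) ^ h = (p : ℝ) ^ a)
    {r : PadicAlgCl p} (hr : aeval r (perturbedCyclotomic w G) = 0) (hr1 : 1 < ‖r‖) :
    ‖r‖ = s ^ 2 := by
  have hh := H.one_le_h
  refine (pow_left_inj₀ (by positivity) (by positivity) (n := h) (by omega)).1 ?_
  rw [H.norm_pow_of_root hr1 hr, hsp]

theorem norm_eq_of_lt_one (H : IsAdmissible p h a w G)
    {s : ℝ} (hs : 1 < s) (hsp : (s ^ 2) ^ h = (p : ℝ) ^ a)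
    {r : PadicAlgCl p} (hr : aeval r (perturbedCyclotomic w G) = 0) (hr1 : ‖r‖ < 1) :
    ‖r‖ = (s ^ 2)⁻¹ := by
  have hh := H.one_le_h
  rw [← inv_inj, inv_inv]
  refine (pow_left_inj₀ (by positivity) (by positivity) (n := h) (by omega)).1 ?_
  rw [H.norm_pow_of_root_of_norm_lt_one hr1 hr, hsp]

theorem norm_aeval_eq_prod (t : PadicAlgCl p) : ‖aeval t (perturbedCyclotomic w G)‖ =
    (((perturbedCyclotomic w G).aroots (PadicAlgCl p)).map fun r => ‖t - r‖).prod := by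
  rw [← eval_map_algebraMap, (IsAlgClosed.splits _).eval_eq_prod_roots_of_monic
    ((monic_perturbedCyclotomic w G).map _), norm_multiset_prod, Multiset.map_map]
  rfl

theorem card_aroots_perturbedCyclotomic {K : Type*} [Field K] [Algebra ℚ K] [IsAlgClosed K] :
    ((perturbedCyclotomic w G).aroots K).card = 20 := by
  rw [IsAlgClosed.card_aroots_eq_natDegree, natDegree_perturbedCyclotomic]

theorem aeval_eq_zero_of_mem {K : Type*} [Field K] [Algebra ℚ K] {r : K}
    (hr : r ∈ (perturbedCyclotomic w G).aroots K) : aeval r (perturbedCyclotomic w G) = 0 :=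
  (mem_aroots.1 hr).2

-- Compute `‖L(t)‖` at the test point in two ways. The perturbation dominates there, giving `‖t‖^(20
-- + h)`; in the product over the roots, each of the `k` large ones contributes `‖t‖^2` and each
-- other one `‖t‖`, giving `‖t‖^(20 + k)`.
open Classical in
theorem card_filter_one_lt_norm (H : IsAdmissible p h a w G) :
    (((perturbedCyclotomic w G).aroots (PadicAlgCl p)).filter fun r => 1 < ‖r‖).card = h := by
  obtain ⟨t, ht, htp⟩ := H.exists_norm_pow
  have hh := H.one_le_h
  have hlt : ‖t‖ ^ h < (p : ℝ) ^ a := by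
    rw [← htp]
    exact pow_lt_pow_left₀ (lt_self_pow₀ ht (by norm_num)) (by positivity) (by omega)
  have h1 := H.norm_aeval_of_norm_pow_lt ht hlt
  set M := (perturbedCyclotomic w G).aroots (PadicAlgCl p) with hM
  have hcard : M.card = 20 := card_aroots_perturbedCyclotomic
  rw [norm_aeval_eq_prod, ← hM, ← Multiset.filter_add_not (fun r => 1 < ‖r‖) M, Multiset.map_add,
    Multiset.prod_add] at h1
  rw [← Multiset.filter_add_not (fun r => 1 < ‖r‖) M, Multiset.card_add] at hcard
  have hA : (M.filter fun r => 1 < ‖r‖).map (fun r => ‖t - r‖) =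
      (M.filter fun r => 1 < ‖r‖).map (fun _ => ‖t‖ ^ 2) := by
    refine Multiset.map_congr rfl fun r hr => ?_
    obtain ⟨hr1, hr2⟩ := Multiset.mem_filter.1 hr
    have hn := H.norm_eq_of_one_lt ht htp (aeval_eq_zero_of_mem hr1) hr2
    have hlt : ‖t‖ < ‖-r‖ := by
      rw [norm_neg, hn]
      exact lt_self_pow₀ ht (by norm_num)
    rw [sub_eq_add_neg, IsUltrametricDist.norm_add_eq_max_of_norm_ne_norm hlt.ne,
      max_eq_right hlt.le, norm_neg, hn]
  have hB : (M.filter fun r => ¬ 1 < ‖r‖).map (fun r => ‖t - r‖) =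
      (M.filter fun r => ¬ 1 < ‖r‖).map (fun _ => ‖t‖) := by
    refine Multiset.map_congr rfl fun r hr => ?_
    obtain ⟨hr1, hr2⟩ := Multiset.mem_filter.1 hr
    have hlt : ‖-r‖ < ‖t‖ := by
      rw [norm_neg]
      exact (not_lt.1 hr2).trans_lt ht
    rw [sub_eq_add_neg, IsUltrametricDist.norm_add_eq_max_of_norm_ne_norm hlt.ne',
      max_eq_left hlt.le]
  rw [hA, hB, Multiset.map_const', Multiset.map_const', Multiset.prod_replicate,
    Multiset.prod_replicate, ← htp, ← pow_mul, ← pow_mul, ← pow_add, ← pow_add] at h1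
  have h2 := pow_right_injective₀ (one_pos.trans ht) ht.ne' h1
  have := H.natDegree_add
  omega

-- The norms of the roots multiply to `‖L(0)‖ = 1`, and small roots have exactly the inverse norm of
-- large ones, so there are equally many of each.
open Classical in
theorem card_filter_norm_lt_one (H : IsAdmissible p h a w G) :
    (((perturbedCyclotomic w G).aroots (PadicAlgCl p)).filter fun r => ‖r‖ < 1).card = h := by
  obtain ⟨t, ht, htp⟩ := H.exists_norm_pow
  have hL := H.card_filter_one_lt_norm
  have h1 := norm_aeval_eq_prod (w := w) (G := G) (0 : PadicAlgCl p)
  set M := (perturbedCyclotomic w G).aroots (PadicAlgCl p) with hM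
  rw [aeval_zero_perturbedCyclotomic, norm_one, ← Multiset.filter_add_not (fun r => 1 < ‖r‖) M,
    Multiset.map_add, Multiset.prod_add,
    ← Multiset.filter_add_not (fun r => ‖r‖ < 1) (M.filter fun r => ¬ 1 < ‖r‖),
    Multiset.map_add, Multiset.prod_add, Multiset.filter_filter, Multiset.filter_filter] at h1
  have hS : (M.filter fun r => ‖r‖ < 1 ∧ ¬ 1 < ‖r‖) = M.filter fun r => ‖r‖ < 1 :=
    Multiset.filter_congr fun r _ => ⟨fun h => h.1, fun h => ⟨h, not_lt.2 h.le⟩⟩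
  have hA : (M.filter fun r => 1 < ‖r‖).map (fun r => ‖0 - r‖) =
      (M.filter fun r => 1 < ‖r‖).map (fun _ => ‖t‖ ^ 2) := by
    refine Multiset.map_congr rfl fun r hr => ?_
    obtain ⟨hr1, hr2⟩ := Multiset.mem_filter.1 hr
    rw [zero_sub, norm_neg, H.norm_eq_of_one_lt ht htp (aeval_eq_zero_of_mem hr1) hr2]
  have hB : (M.filter fun r => ‖r‖ < 1).map (fun r => ‖0 - r‖) =
      (M.filter fun r => ‖r‖ < 1).map (fun _ => (‖t‖ ^ 2)⁻¹) := by
    refine Multiset.map_congr rfl fun r hr => ?_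
    obtain ⟨hr1, hr2⟩ := Multiset.mem_filter.1 hr
    rw [zero_sub, norm_neg, H.norm_eq_of_lt_one ht htp (aeval_eq_zero_of_mem hr1) hr2]
  have hC : (M.filter fun r => ¬ ‖r‖ < 1 ∧ ¬ 1 < ‖r‖).map (fun r => ‖0 - r‖) =
      (M.filter fun r => ¬ ‖r‖ < 1 ∧ ¬ 1 < ‖r‖).map (fun _ => 1) := by
    refine Multiset.map_congr rfl fun r hr => ?_
    obtain ⟨-, hr2, hr3⟩ := Multiset.mem_filter.1 hr
    rw [zero_sub, norm_neg]
    exact le_antisymm (not_lt.1 hr3) (not_lt.1 hr2)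
  have ht2 : 1 < ‖t‖ ^ 2 := one_lt_pow₀ ht (by norm_num)
  rw [hS, hA, hB, hC, Multiset.map_const', Multiset.map_const', Multiset.map_const',
    Multiset.prod_replicate, Multiset.prod_replicate, Multiset.prod_replicate, one_pow, mul_one, hL,
    inv_pow, eq_comm, mul_inv_eq_one₀ (by positivity)] at h1
  exact (pow_right_injective₀ (one_pos.trans ht2) ht2.ne' h1).symm

end IsAdmissible

/-! ### Complex roots -/

namespace IsAdmissible

variable {p h a : ℕ} [Fact p.Prime] {w : ℚ} {G : ℤ[X]}

theorem continuous_eval₂_two_cos :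
    Continuous fun θ : ℝ => G.eval₂ (Int.castRingHom ℝ) (2 * Real.cos θ) := by
  simp only [← eval_map]
  fun_prop

theorem aeval_exp (H : IsAdmissible p h a w G) (θ : ℝ) :
    aeval (Complex.exp (θ * Complex.I)) (perturbedCyclotomic w G) =
      Complex.exp (θ * Complex.I) ^ 10 * ((2 * Real.cos (10 * θ) - 1 +
        w * G.eval₂ (Int.castRingHom ℝ) (2 * Real.cos θ) : ℝ) : ℂ) := by
  rw [aeval_perturbedCyclotomic H.natDegree_lt (Complex.exp_ne_zero _)]
  have h1 : Complex.exp (θ * Complex.I) + (Complex.exp (θ * Complex.I))⁻¹ =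
      ((2 * Real.cos θ : ℝ) : ℂ) := by
    rw [← Complex.exp_neg]
    push_cast
    rw [Complex.two_cos, neg_mul]
  have h2 : Complex.exp (θ * Complex.I) ^ 10 + (Complex.exp (θ * Complex.I))⁻¹ ^ 10 =
      ((2 * Real.cos (10 * θ) : ℝ) : ℂ) := by
    rw [← Complex.exp_neg, ← Complex.exp_nat_mul, ← Complex.exp_nat_mul]
    push_cast
    rw [Complex.two_cos]
    congr 2 <;> ring
  have h3 : G.eval₂ (Int.castRingHom ℂ) ((2 * Real.cos θ : ℝ) : ℂ) =
      ((G.eval₂ (Int.castRingHom ℝ) (2 * Real.cos θ) : ℝ) : ℂ) := by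
    rw [← Complex.ofRealHom_eq_coe, ← Complex.ofRealHom_eq_coe, hom_eval₂,
      RingHom.ext_int (Complex.ofRealHom.comp _) (Int.castRingHom ℂ)]
  rw [h1, h2, h3, eq_ratCast]
  push_cast
  rfl

/-- At `nπ/10` the unperturbed value is `1` or `-3` according to the parity of `n`, and a
perturbation below `1` in absolute value keeps its sign. -/
theorem exists_angle (H : IsAdmissible p h a w G)
    (k : ℕ) : ∃ θ ∈ Set.Ioo (k * Real.pi / 10) ((k + 1 : ℕ) * Real.pi / 10),
    2 * Real.cos (10 * θ) - 1 + w * G.eval₂ (Int.castRingHom ℝ) (2 * Real.cos θ) = 0 := by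
  set φ : ℝ → ℝ := fun θ =>
    2 * Real.cos (10 * θ) - 1 + w * G.eval₂ (Int.castRingHom ℝ) (2 * Real.cos θ) with hφ
  have hcont : Continuous φ := by
    have := continuous_eval₂_two_cos (G := G)
    fun_prop
  have hle : (k : ℝ) * Real.pi / 10 ≤ ((k + 1 : ℕ) : ℝ) * Real.pi / 10 := by
    have := Real.pi_pos
    gcongr
    omega
  have hval (n : ℕ) : |φ (n * Real.pi / 10) - (2 * (-1) ^ n - 1)| < 1 := by
    have hc : Real.cos (10 * (n * Real.pi / 10)) = (-1) ^ n := by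
      rw [show 10 * (n * Real.pi / 10) = n * Real.pi by ring, Real.cos_nat_mul_pi]
    have hb : |2 * Real.cos (n * Real.pi / 10)| ≤ 2 := by
      rw [abs_mul, abs_two]
      linarith [Real.abs_cos_le_one (n * Real.pi / 10)]
    have := H.bound _ hb
    simp only [hφ, hc]
    rwa [add_sub_cancel_left]
  have h1 := abs_lt.1 (hval k)
  have h2 := abs_lt.1 (hval (k + 1))
  rcases Nat.even_or_odd k with hk | hk
  · rw [hk.neg_one_pow] at h1
    rw [hk.add_one.neg_one_pow] at h2
    obtain ⟨θ, hθ, h0⟩ := intermediate_value_Ioo' hle hcont.continuousOn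
      (show (0 : ℝ) ∈ _ from ⟨by linarith, by linarith⟩)
    exact ⟨θ, hθ, h0⟩
  · rw [hk.neg_one_pow] at h1
    rw [hk.add_one.neg_one_pow] at h2
    obtain ⟨θ, hθ, h0⟩ := intermediate_value_Ioo hle hcont.continuousOn
      (show (0 : ℝ) ∈ _ from ⟨by linarith, by linarith⟩)
    exact ⟨θ, hθ, h0⟩

/-- The first twenty angles are increasing and lie in `(0, 2π)`, so they give twenty distinct roots;
by degree there are no others. -/
theorem aroots_complex (H : IsAdmissible p h a w G) : ((perturbedCyclotomic w G).aroots ℂ).Nodup ∧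
    ∀ z ∈ (perturbedCyclotomic w G).aroots ℂ, ∃ θ : ℝ, z = Complex.exp (θ * Complex.I) := by
  classical
  choose θ hθ hroot using H.exists_angle
  have hpi := Real.pi_pos
  obtain ⟨f, hf⟩ : ∃ f : Fin 20 → ℂ, ∀ k, f k = Complex.exp (θ k * Complex.I) := ⟨_, fun _ => rfl⟩
  have hmono : ∀ i j : ℕ, i < j → θ i < θ j := by
    intro i j hij
    refine (hθ i).2.trans_le (le_trans ?_ (hθ j).1.le)
    gcongr
    omega
  have hpos (i : Fin 20) : 0 < θ i := lt_of_le_of_lt (by positivity) (hθ i).1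
  have hlt (i : Fin 20) : θ i < 2 * Real.pi := by
    refine (hθ i).2.trans_le ?_
    have : (((i : ℕ) + 1 : ℕ) : ℝ) ≤ 20 := by exact_mod_cast i.2
    nlinarith
  have hinj : Function.Injective f := by
    intro i j hij
    rw [hf, hf] at hij
    obtain ⟨n, hn⟩ := Complex.exp_eq_exp_iff_exists_int.1 hij
    have hn' : θ i = θ j + n * (2 * Real.pi) := by
      have h1 : ((θ i : ℂ) - (θ j + n * (2 * Real.pi))) * Complex.I = 0 := by
        linear_combination hn
      have h2 := (mul_eq_zero.1 h1).resolve_right Complex.I_ne_zero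
      exact_mod_cast sub_eq_zero.1 h2
    have hn0 : n = 0 := by
      have h3 : (n : ℝ) < 1 := by
        by_contra! hge
        nlinarith [hpos i, hpos j, hlt i, hlt j]
      have h4 : (-1 : ℝ) < n := by
        by_contra! hge
        nlinarith [hpos i, hpos j, hlt i, hlt j]
      have h3' : n < 1 := by exact_mod_cast h3
      have h4' : -1 < n := by exact_mod_cast h4
      omega
    rw [hn0, Int.cast_zero, zero_mul, add_zero] at hn'
    rcases lt_trichotomy (i : ℕ) j with hlt | heq | hlt
    · exact absurd hn' (hmono _ _ hlt).ne
    · exact Fin.ext heq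
    · exact absurd hn' (hmono _ _ hlt).ne'
  have hmem (k : Fin 20) : f k ∈ (perturbedCyclotomic w G).aroots ℂ := by
    refine mem_aroots.2 ⟨(monic_perturbedCyclotomic w G).ne_zero, ?_⟩
    rw [hf, H.aeval_exp, hroot, Complex.ofReal_zero, mul_zero]
  have hS : (Finset.univ.image f).val = (perturbedCyclotomic w G).aroots ℂ := by
    refine Multiset.eq_of_le_of_card_le
      ((Multiset.le_iff_subset (Finset.univ.image f).nodup).2 fun z hz => ?_) ?_
    · rw [Finset.mem_val, Finset.mem_image] at hz
      obtain ⟨k, -, hk⟩ := hz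
      rw [← hk]
      exact hmem k
    · rw [card_aroots_perturbedCyclotomic, Finset.card_val, Finset.card_image_of_injective _ hinj]
      simp
  refine ⟨hS ▸ (Finset.univ.image f).nodup, fun z hz => ?_⟩
  rw [← hS, Finset.mem_val, Finset.mem_image] at hz
  obtain ⟨k, -, hk⟩ := hz
  exact ⟨θ k, hk.symm.trans (hf k)⟩

theorem separable (H : IsAdmissible p h a w G) : (perturbedCyclotomic w G).Separable :=
  (nodup_aroots_iff_of_splits (monic_perturbedCyclotomic w G).ne_zero
    (IsAlgClosed.splits _)).1 H.aroots_complex.1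

theorem exists_angle_of_root (H : IsAdmissible p h a w G)
    {z : ℂ} (hz : aeval z (perturbedCyclotomic w G) = 0) :
    ∃ θ : ℝ, z = Complex.exp (θ * Complex.I) :=
  H.aroots_complex.2 z (mem_aroots.2 ⟨(monic_perturbedCyclotomic w G).ne_zero, hz⟩)

theorem norm_eq_one_of_root (H : IsAdmissible p h a w G)
    {z : ℂ} (hz : aeval z (perturbedCyclotomic w G) = 0) : ‖z‖ = 1 := by
  obtain ⟨θ, rfl⟩ := H.exists_angle_of_root hz
  exact Complex.norm_exp_ofReal_mul_I θ

theorem norm_cyclotomic_lt_one_of_root (H : IsAdmissible p h a w G)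
    {z : ℂ} (hz : aeval z (perturbedCyclotomic w G) = 0) :
    ‖z ^ 20 - z ^ 10 + 1‖ < 1 := by
  obtain ⟨θ, rfl⟩ := H.exists_angle_of_root hz
  have h0 : Complex.exp (θ * Complex.I) ≠ 0 := Complex.exp_ne_zero _
  have h1 := hz
  rw [H.aeval_exp] at h1
  have h2 : 2 * Real.cos (10 * θ) - 1 + w * G.eval₂ (Int.castRingHom ℝ) (2 * Real.cos θ) = 0 := by
    exact_mod_cast (mul_eq_zero.1 h1).resolve_left (pow_ne_zero _ h0)
  have h3 : Complex.exp (θ * Complex.I) ^ 20 - Complex.exp (θ * Complex.I) ^ 10 + 1 =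
      Complex.exp (θ * Complex.I) ^ 10 * ((2 * Real.cos (10 * θ) - 1 : ℝ) : ℂ) := by
    have h4 : ((2 * Real.cos (10 * θ) : ℝ) : ℂ) =
        Complex.exp (θ * Complex.I) ^ 10 + (Complex.exp (θ * Complex.I) ^ 10)⁻¹ := by
      rw [← Complex.exp_nat_mul, ← Complex.exp_neg]
      push_cast
      rw [Complex.two_cos]
      congr 2 <;> ring
    rw [Complex.ofReal_sub, h4]
    field_simp
    push_cast
    ring
  have hb : |2 * Real.cos θ| ≤ 2 := by
    rw [abs_mul, abs_two]
    linarith [Real.abs_cos_le_one θ]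
  rw [h3, norm_mul, norm_pow, Complex.norm_exp_ofReal_mul_I, one_pow, one_mul, Complex.norm_real,
    show 2 * Real.cos (10 * θ) - 1 = -(w * G.eval₂ (Int.castRingHom ℝ) (2 * Real.cos θ)) by
      linarith,
    norm_neg, Real.norm_eq_abs]
  exact H.bound _ hb

end IsAdmissible

/-! ### Square discriminants -/

theorem isSquare_discr_of_isSquare_discr_basis {K ι : Type*} [Field K] [NumberField K] [Fintype ι]
    [DecidableEq ι] (b : Module.Basis ι ℚ K) (hb : IsSquare (Algebra.discr ℚ b)) :
    IsSquare (NumberField.discr K) := by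
  rw [← Rat.isSquare_intCast_iff, NumberField.coe_discr]
  set c := (NumberField.integralBasis K).reindex
    ((NumberField.integralBasis K).indexEquiv b) with hc
  have h1 : Algebra.discr ℚ c = Algebra.discr ℚ (NumberField.integralBasis K) := by
    rw [hc, Module.Basis.coe_reindex, Algebra.discr_reindex]
  rw [← h1]
  have h2 := Algebra.discr_of_matrix_vecMul c (c.toMatrix b)
  rw [Module.Basis.toMatrix_map_vecMul] at h2
  have h3 := Algebra.discr_not_zero_of_basis ℚ b
  have h4 : (c.toMatrix b).det ≠ 0 := fun h0 => h3 (by rw [h2, h0]; simp)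
  obtain ⟨s, hs⟩ := hb
  refine ⟨s / (c.toMatrix b).det, ?_⟩
  rw [hs] at h2
  field_simp
  linear_combination -h2

theorem norm_algebraMap_sub_gen {F K : Type*} [Field F] [Field K] [Algebra F K]
    (pb : PowerBasis F K) (x : F) :
    Algebra.norm F (algebraMap F K x - pb.gen) = (minpoly F pb.gen).eval x := by
  classical
  rw [Algebra.norm_eq_matrix_det pb.basis, map_sub, ← charpoly_leftMulMatrix, Matrix.eval_charpoly,
    AlgHom.commutes]
  rfl

/-- Over the fixed field `E` of `σ`, of codegree two, the norm of `y` is `y^2`; transitivity of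
norms finishes. -/
theorem isSquare_norm_of_involution {F K : Type*} [Field F] [Field K] [Algebra F K]
    [FiniteDimensional F K] (σ : K ≃ₐ[F] K) (hσ : orderOf σ = 2) {y : K} (hy : σ y = y) :
    IsSquare (Algebra.norm F y) := by
  classical
  set E := fixedField (Subgroup.zpowers σ)
  have hfin : Module.finrank E K = 2 := by
    rw [finrank_fixedField_eq_card, Nat.card_zpowers, hσ]
  have hyE : y ∈ E := by
    rintro ⟨τ, n, rfl⟩
    have h1 : Subgroup.zpowers σ ≤ MulAction.stabilizer (K ≃ₐ[F] K) y :=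
      Subgroup.zpowers_le.2 hy
    exact h1 (Subgroup.zpow_mem_zpowers σ n)
  have h2 := Algebra.norm_norm (R := F) (S := E) (a := (algebraMap E K ⟨y, hyE⟩))
  rw [Algebra.norm_algebraMap, hfin, map_pow] at h2
  exact ⟨_, h2.symm.trans (sq _)⟩

/-- This is the derivative of `L(T) = T^n L(1/T)` at a root. In coefficients, the weights `i` and `n
- i` add up to `n`, and `n L(z) = 0`. -/
theorem aeval_derivative_of_reflect {K : Type*} [Field K] [Algebra ℚ K] {L : ℚ[X]} {n : ℕ}
    (hdeg : L.natDegree ≤ n) (hrefl : L.reflect n = L) {z : K} (hz : z ≠ 0)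
    (hroot : aeval z L = 0) :
    z ^ 2 * aeval z (derivative L) = - (z ^ n * aeval z⁻¹ (derivative L)) := by
  have hsum (x : K) : x * aeval x (derivative L) =
      ∑ i ∈ Finset.range (n + 1), (i : K) * (algebraMap ℚ K (L.coeff i) * x ^ i) := by
    conv_lhs => rw [L.as_sum_range_C_mul_X_pow' (n := n + 1) (by omega)]
    rw [derivative_sum, map_sum, Finset.mul_sum]
    refine Finset.sum_congr rfl fun i _ => ?_
    rcases i with _ | i
    · simp
    · simp only [derivative_C_mul_X_pow, map_mul, aeval_C, map_pow, aeval_X, map_natCast,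
        Nat.add_sub_cancel]
      ring
  have hcoeff (i : ℕ) (hi : i ≤ n) : L.coeff (n - i) = L.coeff i := by
    conv_rhs => rw [← hrefl, coeff_reflect, revAt_le hi]
  have h0 : ∑ i ∈ Finset.range (n + 1), algebraMap ℚ K (L.coeff i) * z ^ i = 0 := by
    rw [aeval_eq_sum_range' (n := n + 1) (by omega)] at hroot
    simpa only [Algebra.smul_def] using hroot
  have h1 : z ^ n * (z⁻¹ * aeval z⁻¹ (derivative L)) = - (z * aeval z (derivative L)) := by
    rw [hsum, hsum, ← Finset.sum_range_reflect, eq_neg_iff_add_eq_zero, Finset.mul_sum,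
      ← Finset.sum_add_distrib, ← mul_zero (n : K), ← h0, Finset.mul_sum]
    refine Finset.sum_congr rfl fun i hi => ?_
    have hi' : i ≤ n := Nat.lt_succ_iff.1 (Finset.mem_range.1 hi)
    have h2 : z ^ n = z ^ (n - i) * z ^ i := by rw [← pow_add]; congr 1; omega
    rw [show n + 1 - 1 - i = n - i by omega, hcoeff i hi', h2, inv_pow, Nat.cast_sub hi']
    field_simp
    ring
  calc z ^ 2 * aeval z (derivative L) = -(z * -(z * aeval z (derivative L))) := by ring
    _ = _ := by
      rw [← h1]
      field_simp

theorem isSquare_discr_of_reflect {K : Type*} [Field K] [NumberField K] (pb : PowerBasis ℚ K)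
    {L : ℚ[X]} (hL : minpoly ℚ pb.gen = L) (hdeg : L.natDegree = 20) (hrefl : L.reflect 20 = L)
    (hsq : IsSquare (L.eval 1 * L.eval (-1))) : IsSquare (NumberField.discr K) := by
  refine isSquare_discr_of_isSquare_discr_basis pb.basis ?_
  have hfin : Module.finrank ℚ K = 20 := by
    rw [pb.finrank, ← pb.natDegree_minpoly, hL, hdeg]
  -- The sign `(-1)^(20 * 19 / 2)` is `+1`.
  rw [Algebra.discr_powerBasis_eq_norm, hfin, hL, Even.neg_one_pow (by decide), one_mul]
  set γ := pb.gen with hγ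
  have hroot : aeval γ L = 0 := hL ▸ minpoly.aeval ℚ γ
  have hpm (x : ℚ) : γ ≠ algebraMap ℚ K x := by
    intro h
    have : (minpoly ℚ γ).natDegree = 1 := by rw [h, minpoly.natDegree_eq_one_iff]; exact ⟨x, rfl⟩
    rw [hL, hdeg] at this
    norm_num at this
  have hγ0 : γ ≠ 0 := by simpa using hpm 0
  have hγ1 : γ ^ 2 - 1 ≠ 0 := by
    have h1 : γ - 1 ≠ 0 := sub_ne_zero.2 (by simpa using hpm 1)
    have h2 : γ + 1 ≠ 0 := by
      intro h
      exact hpm (-1) (by rw [map_neg, map_one]; exact eq_neg_of_add_eq_zero_left h)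
    have : γ ^ 2 - 1 = (γ - 1) * (γ + 1) := by ring
    rw [this]
    exact mul_ne_zero h1 h2
  have hinv : aeval γ⁻¹ L = 0 := by
    have := invertibleOfNonzero hγ0
    have h1 := eval₂_reflect_mul_pow (algebraMap ℚ K) γ 20 L hdeg.le
    rw [hrefl, invOf_eq_inv, ← aeval_def, ← aeval_def, hroot] at h1
    exact (mul_eq_zero.1 h1).resolve_right (pow_ne_zero _ hγ0)
  set τ : K →ₐ[ℚ] K := pb.lift γ⁻¹ (by rw [hL]; exact hinv) with hτ
  have hτγ : τ γ = γ⁻¹ := pb.lift_gen _ _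
  set σ : K ≃ₐ[ℚ] K := AlgEquiv.ofBijective τ (Algebra.IsAlgebraic.algHom_bijective τ) with hσ
  have hσγ : σ γ = γ⁻¹ := hτγ
  have hord : orderOf σ = 2 := by
    refine orderOf_eq_prime ?_ fun h1 => ?_
    · have h1 : ((σ ^ 2 : K ≃ₐ[ℚ] K) : K →ₐ[ℚ] K) = AlgHom.id ℚ K := by
        refine pb.algHom_ext ?_
        change (σ ^ 2) γ = γ
        rw [sq, AlgEquiv.mul_apply, hσγ, map_inv₀, hσγ, inv_inv]
      ext x
      exact DFunLike.congr_fun h1 x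
    · rw [h1, AlgEquiv.one_apply] at hσγ
      refine hγ1 ?_
      rw [sub_eq_zero, sq]
      nth_rw 2 [hσγ]
      exact mul_inv_cancel₀ hγ0
  set D := aeval γ (derivative L) with hD
  have hDσ : σ D = aeval γ⁻¹ (derivative L) := by
    rw [hD, ← hσγ, aeval_algHom_apply]
  have hrel := aeval_derivative_of_reflect hdeg.le hrefl hγ0 hroot
  rw [← hDσ, ← hD] at hrel
  -- Inversion multiplies both `D` and `γ^8 (γ^2 - 1)` by `-γ^(-18)`, so the quotient is invariant.
  set y := D / (γ ^ 8 * (γ ^ 2 - 1)) with hy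
  have hσy : σ y = y := by
    have h1 : γ⁻¹ ^ 2 - 1 ≠ 0 := by
      intro h
      apply hγ1
      field_simp at h
      linear_combination -h
    rw [hy, map_div₀, map_mul, map_sub, map_pow, map_pow, map_one, hσγ,
      div_eq_div_iff (mul_ne_zero (pow_ne_zero _ (inv_ne_zero hγ0)) h1)
        (mul_ne_zero (pow_ne_zero _ hγ0) hγ1)]
    field_simp
    refine mul_left_cancel₀ (pow_ne_zero 2 hγ0) ?_
    linear_combination (γ ^ 2 - 1) * hrel
  have hDy : D = γ ^ 8 * ((algebraMap ℚ K 1 - γ) * (algebraMap ℚ K (-1) - γ)) * y := by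
    have h1 : (algebraMap ℚ K 1 - γ) * (algebraMap ℚ K (-1) - γ) = γ ^ 2 - 1 := by
      rw [map_neg, map_one]; ring
    rw [h1, hy]
    field_simp
  rw [hDy, map_mul, map_mul, map_mul, hγ, norm_algebraMap_sub_gen, norm_algebraMap_sub_gen, hL,
    map_pow]
  refine ((Even.isSquare_pow (by decide) _).mul hsq).mul (isSquare_norm_of_involution σ hord hσy)

/-! ### Irreducibility over `ℚ` -/

theorem exists_int_eq_of_padic_norm_le_one {p : ℕ} [Fact p.Prime] {N : ℚ} {k : ℕ} {m : ℤ}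
    (hN : ‖(N : ℚ_[p])‖ ≤ 1) (hm : N * (p : ℚ) ^ k = m) : ∃ c : ℤ, N = c := by
  have hp : (p : ℚ) ^ k ≠ 0 := pow_ne_zero _ (by exact_mod_cast (Fact.out : p.Prime).ne_zero)
  have h1 : ‖(m : ℚ_[p])‖ ≤ (p : ℝ) ^ (-k : ℤ) := by
    have h2 : (m : ℚ_[p]) = (N : ℚ_[p]) * (p : ℚ_[p]) ^ k := by exact_mod_cast hm.symm
    rw [h2, norm_mul, Padic.norm_p_pow]
    exact mul_le_of_le_one_left (by positivity) hN
  obtain ⟨c, hc⟩ := (Padic.norm_int_le_pow_iff_dvd m k).1 h1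
  refine ⟨c, mul_right_cancel₀ hp ?_⟩
  rw [hm, hc]
  push_cast
  ring

namespace IsAdmissible

variable {p h a : ℕ} [Fact p.Prime] {w : ℚ} {G : ℤ[X]}

theorem isIntegral_of_root {K : Type*} [Field K] [Algebra ℚ K] {r : K}
    (hr : aeval r (perturbedCyclotomic w G) = 0) : IsIntegral ℚ r :=
  ⟨_, monic_perturbedCyclotomic w G, hr⟩

theorem aroots_map_padic :
    ((perturbedCyclotomic w G).map (algebraMap ℚ ℚ_[p])).aroots (PadicAlgCl p) =
      (perturbedCyclotomic w G).aroots (PadicAlgCl p) :=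
  aroots_map _ _ _

theorem map_padic_ne_zero : (perturbedCyclotomic w G).map (algebraMap ℚ ℚ_[p]) ≠ 0 :=
  Polynomial.map_ne_zero (monic_perturbedCyclotomic w G).ne_zero

open Classical in
theorem aroots_minpoly_of_one_lt (H : IsAdmissible p h a w G) {r : PadicAlgCl p}
    (hr : aeval r (perturbedCyclotomic w G) = 0) (hr1 : 1 < ‖r‖) :
    (minpoly ℚ_[p] r).aroots (PadicAlgCl p) =
      ((perturbedCyclotomic w G).aroots (PadicAlgCl p)).filter fun s => 1 < ‖s‖ := by
  obtain ⟨t, ht, htp⟩ := H.exists_norm_pow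
  have hfilter : (((perturbedCyclotomic w G).aroots (PadicAlgCl p)).filter fun s => ‖s‖ = ‖r‖) =
      ((perturbedCyclotomic w G).aroots (PadicAlgCl p)).filter fun s => 1 < ‖s‖ := by
    refine Multiset.filter_congr fun s hs => ⟨fun h1 => h1 ▸ hr1, fun h1 => ?_⟩
    rw [H.norm_eq_of_one_lt ht htp (aeval_eq_zero_of_mem hs) h1, H.norm_eq_of_one_lt ht htp hr hr1]
  have h2 := aroots_minpoly_eq_filter_norm (p := p) (map_padic_ne_zero (w := w) (G := G)) (r := r)
    (h := h) (e := a) (Nat.isCoprime_iff_coprime.2 H.coprime)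
    (by rwa [aeval_map_algebraMap]) (by rw [H.norm_pow_of_root hr1 hr, zpow_natCast])
    (ne_zero_of_aeval_perturbedCyclotomic hr)
  rw [aroots_map_padic, hfilter] at h2
  exact h2 H.card_filter_one_lt_norm.le

open Classical in
theorem aroots_minpoly_of_lt_one (H : IsAdmissible p h a w G) {r : PadicAlgCl p}
    (hr : aeval r (perturbedCyclotomic w G) = 0) (hr1 : ‖r‖ < 1) :
    (minpoly ℚ_[p] r).aroots (PadicAlgCl p) =
      ((perturbedCyclotomic w G).aroots (PadicAlgCl p)).filter fun s => ‖s‖ < 1 := by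
  obtain ⟨t, ht, htp⟩ := H.exists_norm_pow
  have hfilter : (((perturbedCyclotomic w G).aroots (PadicAlgCl p)).filter fun s => ‖s‖ = ‖r‖) =
      ((perturbedCyclotomic w G).aroots (PadicAlgCl p)).filter fun s => ‖s‖ < 1 := by
    refine Multiset.filter_congr fun s hs => ⟨fun h1 => h1 ▸ hr1, fun h1 => ?_⟩
    rw [H.norm_eq_of_lt_one ht htp (aeval_eq_zero_of_mem hs) h1, H.norm_eq_of_lt_one ht htp hr hr1]
  have h2 := aroots_minpoly_eq_filter_norm (p := p) (map_padic_ne_zero (w := w) (G := G)) (r := r)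
    (h := h) (e := -a) (Nat.isCoprime_iff_coprime.2 H.coprime).neg_right
    (by rwa [aeval_map_algebraMap])
    (by rw [zpow_neg, zpow_natCast, ← H.norm_pow_of_root_of_norm_lt_one hr1 hr, inv_pow, inv_inv])
    (ne_zero_of_aeval_perturbedCyclotomic hr)
  rw [aroots_map_padic, hfilter] at h2
  exact h2 H.card_filter_norm_lt_one.le

theorem exists_root_one_lt (H : IsAdmissible p h a w G) :
    ∃ r : PadicAlgCl p, aeval r (perturbedCyclotomic w G) = 0 ∧ 1 < ‖r‖ := by
  classical
  have h1 := H.card_filter_one_lt_norm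
  have h2 := H.one_le_h
  obtain ⟨r, hr⟩ := Multiset.card_pos_iff_exists_mem.1 (h1 ▸ h2)
  obtain ⟨hr1, hr2⟩ := Multiset.mem_filter.1 hr
  exact ⟨r, aeval_eq_zero_of_mem hr1, hr2⟩

theorem minpoly_eq_of_one_lt (H : IsAdmissible p h a w G) {r s : PadicAlgCl p}
    (hr : aeval r (perturbedCyclotomic w G) = 0) (hr1 : 1 < ‖r‖)
    (hs : aeval s (perturbedCyclotomic w G) = 0) (hs1 : 1 < ‖s‖) :
    minpoly ℚ s = minpoly ℚ r := by
  classical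
  have hmem : s ∈ (minpoly ℚ_[p] r).aroots (PadicAlgCl p) := by
    rw [H.aroots_minpoly_of_one_lt hr hr1]
    exact Multiset.mem_filter.2
      ⟨mem_aroots.2 ⟨(monic_perturbedCyclotomic w G).ne_zero, hs⟩, hs1⟩
  obtain ⟨q, hq⟩ := minpoly.dvd_map_of_isScalarTower ℚ ℚ_[p] r
  have h1 : aeval s (minpoly ℚ r) = 0 := by
    rw [← aeval_map_algebraMap ℚ_[p], hq, map_mul, (mem_aroots.1 hmem).2, zero_mul]
  exact (minpoly.eq_of_irreducible_of_monic (minpoly.irreducible (isIntegral_of_root hr)) h1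
    (minpoly.monic (isIntegral_of_root hr))).symm

/-- Clearing the denominator of `w` gives an integer polynomial with leading coefficient `p^a`. -/
theorem isIntegral_pow_mul_of_root (H : IsAdmissible p h a w G)
    {K : Type*} [Field K] [Algebra ℚ K] {g : K}
    (hg : aeval g (perturbedCyclotomic w G) = 0) : IsIntegral ℤ ((p : K) ^ a * g) := by
  obtain ⟨u, hu⟩ := H.denominator
  set F : ℤ[X] := C ((p : ℤ) ^ a) * (X ^ 20 - X ^ 10 + 1) + C u * reciprocalLift G with hF
  have hmap : F.map (Int.castRingHom ℚ) = C ((p : ℚ) ^ a) * perturbedCyclotomic w G := by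
    have h1 : Int.castRingHom ℚ u = (p : ℚ) ^ a * w := by rw [eq_intCast, ← hu, mul_comm]
    have h2 : Int.castRingHom ℚ ((p : ℤ) ^ a) = (p : ℚ) ^ a := by simp
    rw [hF, perturbedCyclotomic, Polynomial.map_add, Polynomial.map_mul, Polynomial.map_mul, map_C,
      map_C, h1, h2, C_mul]
    simp only [Polynomial.map_add, Polynomial.map_sub, Polynomial.map_pow, map_X,
      Polynomial.map_one]
    ring
  have hlead : F.leadingCoeff = (p : ℤ) ^ a := by
    have h1 := leadingCoeff_map_of_injective (RingHom.injective_int (Int.castRingHom ℚ)) F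
    rw [hmap, leadingCoeff_mul, leadingCoeff_C, (monic_perturbedCyclotomic w G).leadingCoeff,
      mul_one] at h1
    rw [eq_intCast] at h1
    exact_mod_cast h1.symm
  have hroot : aeval g F = 0 := by
    have h1 : aeval g (F.map (Int.castRingHom ℚ)) = 0 := by rw [hmap, map_mul, hg, mul_zero]
    rwa [← algebraMap_int_eq, aeval_map_algebraMap] at h1
  have h2 := isIntegral_leadingCoeff_smul F g hroot
  rw [hlead, zsmul_eq_mul] at h2
  exact_mod_cast h2

theorem cyclotomic_ne_zero_of_root (H : IsAdmissible p h a w G)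
    {z : ℂ} (hz : aeval z (perturbedCyclotomic w G) = 0) :
    z ^ 20 - z ^ 10 + 1 ≠ 0 := by
  intro h0
  have hz0 : z ≠ 0 := ne_zero_of_aeval_perturbedCyclotomic hz
  refine H.no_common_root z hz0 ?_ h0
  have h1 := hz
  rw [aeval_perturbedCyclotomic H.natDegree_lt hz0, mul_add] at h1
  have h2 : z ^ 10 * (z ^ 10 + z⁻¹ ^ 10 - 1) = 0 := by
    rw [← h0]
    field_simp
    ring
  rw [h2, zero_add] at h1
  have hw : w ≠ 0 := by
    rintro rfl
    have h3 := H.norm_w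
    have h4 := H.one_lt_pow
    rw [← h3, Rat.cast_zero, norm_zero] at h4
    linarith
  refine ((mul_eq_zero.1 ((mul_eq_zero.1 h1).resolve_left (pow_ne_zero _ hz0))).resolve_left ?_)
  simpa using hw

/-- Otherwise the norm `N` of `y = g^20 - g^10 + 1` is a `p`-adic integer with only powers of `p` in
its denominator, hence an integer. At every complex place `y` is nonzero of absolute value below
one, so `0 < |N| < 1`. -/
theorem exists_conjugate_one_lt (H : IsAdmissible p h a w G)
    {β : Qbar} (hβ : aeval β (perturbedCyclotomic w G) = 0) :
    ∃ s : PadicAlgCl p, aeval s (minpoly ℚ β) = 0 ∧ 1 < ‖s‖ := by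
  by_contra! hno
  set g : ℚ⟮β⟯ := AdjoinSimple.gen ℚ β with hg
  have hmin : minpoly ℚ g = minpoly ℚ β := minpoly_gen ℚ β
  have hgroot : aeval g (perturbedCyclotomic w G) = 0 := by
    rw [← minpoly.dvd_iff, hmin, minpoly.dvd_iff, hβ]
  set y : ℚ⟮β⟯ := g ^ 20 - g ^ 10 + 1 with hy
  have hembC (σ : ℚ⟮β⟯ →ₐ[ℚ] ℂ) : aeval (σ g) (perturbedCyclotomic w G) = 0 := by
    rw [aeval_algHom_apply, hgroot, map_zero]
  have hσy (σ : ℚ⟮β⟯ →ₐ[ℚ] ℂ) : σ y = σ g ^ 20 - σ g ^ 10 + 1 := by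
    simp [hy]
  have hcard : 0 < Fintype.card (ℚ⟮β⟯ →ₐ[ℚ] ℂ) := by
    rw [AlgHom.card]
    exact Module.finrank_pos
  have hne : Nonempty (ℚ⟮β⟯ →ₐ[ℚ] ℂ) := Fintype.card_pos_iff.1 hcard
  set N := Algebra.norm ℚ y with hN
  have hreal : |(N : ℝ)| < 1 := by
    have h1 := congrArg norm (Algebra.norm_eq_prod_embeddings ℚ ℂ y)
    rw [← hN, eq_ratCast, norm_prod] at h1
    have h2 : ‖(N : ℂ)‖ = |(N : ℝ)| := by
      rw [← Complex.ofReal_ratCast, Complex.norm_real, Real.norm_eq_abs]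
    rw [← h2, h1]
    calc ∏ σ : ℚ⟮β⟯ →ₐ[ℚ] ℂ, ‖σ y‖ < ∏ σ : ℚ⟮β⟯ →ₐ[ℚ] ℂ, (1 : ℝ) := by
          refine Finset.prod_lt_prod_of_nonempty (fun σ _ => ?_) (fun σ _ => ?_)
            Finset.univ_nonempty
          · rw [norm_pos_iff, hσy]
            exact H.cyclotomic_ne_zero_of_root (hembC σ)
          · rw [hσy]
            exact H.norm_cyclotomic_lt_one_of_root (hembC σ)
      _ = 1 := by simp
  have hpadic : ‖(N : ℚ_[p])‖ ≤ 1 := by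
    have h1 := congrArg norm (Algebra.norm_eq_prod_embeddings ℚ (PadicAlgCl p) y)
    rw [← hN, IsScalarTower.algebraMap_apply ℚ ℚ_[p] (PadicAlgCl p), norm_algebraMap', eq_ratCast,
      norm_prod] at h1
    rw [h1]
    refine Finset.prod_le_one (fun _ _ => norm_nonneg _) fun σ _ => ?_
    have h2 : ‖σ g‖ ≤ 1 := by
      refine hno _ ?_
      rw [← hmin, aeval_algHom_apply, minpoly.aeval, map_zero]
    have h3 : σ y = σ g ^ 20 + (-(σ g ^ 10) + 1) := by
      simp only [hy, map_add, map_sub, map_pow, map_one]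
      ring
    rw [h3]
    refine (IsUltrametricDist.norm_add_le_max _ _).trans (max_le ?_ ?_)
    · rw [norm_pow]
      exact pow_le_one₀ (norm_nonneg _) h2
    · refine (IsUltrametricDist.norm_add_le_max _ _).trans (max_le ?_ (by simp))
      rw [norm_neg, norm_pow]
      exact pow_le_one₀ (norm_nonneg _) h2
  -- The factor `p^a` is needed once for each power of `g`, and `y` has degree `20` in `g`.
  have hint : IsIntegral ℤ ((p : ℚ⟮β⟯) ^ (20 * a) * y) := by
    have h1 := H.isIntegral_pow_mul_of_root hgroot
    have h2 : IsIntegral ℤ (p : ℚ⟮β⟯) := isIntegral_natCast p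
    have h3 : (p : ℚ⟮β⟯) ^ (20 * a) * y = ((p : ℚ⟮β⟯) ^ a * g) ^ 20 -
        (p : ℚ⟮β⟯) ^ (10 * a) * ((p : ℚ⟮β⟯) ^ a * g) ^ 10 + (p : ℚ⟮β⟯) ^ (20 * a) := by
      rw [hy]; ring
    rw [h3]
    exact ((h1.pow 20).sub ((h2.pow _).mul (h1.pow 10))).add (h2.pow _)
  obtain ⟨m, hm⟩ : ∃ m : ℤ, N * (p : ℚ) ^ (20 * a * Module.finrank ℚ ℚ⟮β⟯) = m := by
    have h1 := Algebra.isIntegral_norm ℚ hint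
    obtain ⟨m, hm⟩ := IsIntegrallyClosed.isIntegral_iff.1 h1
    refine ⟨m, ?_⟩
    have h2 : (p : ℚ⟮β⟯) ^ (20 * a) = algebraMap ℚ ℚ⟮β⟯ ((p : ℚ) ^ (20 * a)) := by simp
    rw [h2, map_mul, Algebra.norm_algebraMap, ← pow_mul, ← hN] at hm
    rw [mul_comm, ← hm]
    rfl
  obtain ⟨c, hc⟩ := exists_int_eq_of_padic_norm_le_one hpadic hm
  have hc0 : c = 0 := by
    rw [hc, Rat.cast_intCast, ← Int.cast_abs] at hreal
    exact Int.abs_lt_one_iff.1 (by exact_mod_cast hreal)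
  rw [hc0, Int.cast_zero, hN, Algebra.norm_eq_zero_iff] at hc
  obtain ⟨σ⟩ := hne
  exact H.cyclotomic_ne_zero_of_root (hembC σ) (by rw [← hσy, hc, map_zero])

/-- A root `β` of the cofactor `B` has a conjugate of norm above one, hence the minimal polynomial
of `r`. By separability `B` is coprime to that polynomial, so `B` has no root. -/
theorem minpoly_of_root_one_lt (H : IsAdmissible p h a w G) {r : PadicAlgCl p}
    (hr : aeval r (perturbedCyclotomic w G) = 0) (hr1 : 1 < ‖r‖) :
    minpoly ℚ r = perturbedCyclotomic w G := by
  have hint := isIntegral_of_root hr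
  obtain ⟨B, hB⟩ := minpoly.dvd ℚ r hr
  have hcop : IsCoprime (minpoly ℚ r) B := Separable.isCoprime (hB ▸ H.separable)
  have hBmonic : B.Monic :=
    (minpoly.monic hint).of_mul_monic_left (hB ▸ monic_perturbedCyclotomic w G)
  suffices h : B.degree = 0 by
    rw [hB, hBmonic.eq_one_of_isUnit (isUnit_iff_degree_eq_zero.2 h), mul_one]
  by_contra hdeg
  obtain ⟨β, hβ⟩ := IsAlgClosed.exists_aeval_eq_zero Qbar B hdeg
  have hβL : aeval β (perturbedCyclotomic w G) = 0 := by rw [hB, map_mul, hβ, mul_zero]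
  obtain ⟨s, hs, hs1⟩ := H.exists_conjugate_one_lt hβL
  have hsL : aeval s (perturbedCyclotomic w G) = 0 := by
    obtain ⟨A, hA⟩ := minpoly.dvd ℚ β hβL
    rw [hA, map_mul, hs, zero_mul]
  have h1 : minpoly ℚ s = minpoly ℚ β :=
    (minpoly.eq_of_irreducible_of_monic (minpoly.irreducible (isIntegral_of_root hβL)) hs
      (minpoly.monic (isIntegral_of_root hβL))).symm
  have h2 : aeval β (minpoly ℚ r) = 0 := by
    rw [← H.minpoly_eq_of_one_lt hr hr1 hsL hs1, h1, minpoly.aeval]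
  obtain ⟨x, y, hxy⟩ := hcop
  have h3 := congrArg (aeval β) hxy
  rw [map_add, map_mul, map_mul, h2, hβ, mul_zero, mul_zero, add_zero, map_one] at h3
  exact zero_ne_one h3

theorem irreducible (H : IsAdmissible p h a w G) : Irreducible (perturbedCyclotomic w G) := by
  obtain ⟨r, hr, hr1⟩ := H.exists_root_one_lt
  rw [← H.minpoly_of_root_one_lt hr hr1]
  exact minpoly.irreducible (isIntegral_of_root hr)

theorem minpoly_of_root (H : IsAdmissible p h a w G) {K : Type*} [Field K] [Algebra ℚ K] {z : K}
    (hz : aeval z (perturbedCyclotomic w G) = 0) : minpoly ℚ z = perturbedCyclotomic w G :=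
  (minpoly.eq_of_irreducible_of_monic H.irreducible hz (monic_perturbedCyclotomic w G)).symm

theorem pow_ne_one_of_root (H : IsAdmissible p h a w G)
    {z : ℂ} (hz : aeval z (perturbedCyclotomic w G) = 0) {n : ℕ}
    (hn : 1 ≤ n) : z ^ n ≠ 1 := by
  intro h1
  obtain ⟨r, hr, hr1⟩ := H.exists_root_one_lt
  have hdvd : perturbedCyclotomic w G ∣ X ^ n - 1 := by
    rw [← H.minpoly_of_root hz]
    exact minpoly.dvd _ _ (by simp [h1])
  obtain ⟨A, hA⟩ := hdvd
  have h2 := congrArg (aeval r) hA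
  rw [map_mul, hr, zero_mul, map_sub, map_pow, aeval_X, map_one, sub_eq_zero] at h2
  have h3 := congrArg norm h2
  rw [norm_pow, norm_one] at h3
  exact (one_lt_pow₀ hr1 (by omega)).ne' h3

end IsAdmissible

/-! ### Slopes, the negative part and integrality away from `p` -/

theorem Polynomial.Monic.eq_C_coeff_zero_mul_prod_one_sub {K : Type*} [Field K] {f : K[X]}
    (hf : f.Monic) (hs : f.Splits) (h0 : f.coeff 0 ≠ 0) :
    f = C (f.coeff 0) * (f.roots.map fun s => 1 - C s⁻¹ * X).prod := by
  have h1 : f.coeff 0 = (f.roots.map fun s => -s).prod := by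
    rw [coeff_zero_eq_eval_zero, hs.eval_eq_prod_roots_of_monic hf]
    simp
  have h2 : ∀ s ∈ f.roots, X - C s = C (-s) * (1 - C s⁻¹ * X) := by
    intro s hs
    have hs0 : s ≠ 0 := by
      rintro rfl
      exact h0 (coeff_zero_eq_eval_zero f ▸ isRoot_of_mem_roots hs)
    rw [mul_sub, ← mul_assoc, ← C_mul, neg_mul, mul_inv_cancel₀ hs0]
    simp
    ring
  conv_lhs => rw [hs.eq_prod_roots_of_monic hf, Multiset.map_congr rfl h2, Multiset.prod_map_mul]
  rw [h1, map_multiset_prod, Multiset.map_map]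
  rfl

theorem Multiset.exists_fin_enumeration {β : Type*} (A B D : Multiset β) {m h : ℕ} (hm : h ≤ m)
    (hA : A.card = h) (hB : B.card = 2 * m - 2 * h) (hD : D.card = h) :
    ∃ f : Fin (2 * m) → β, A + B + D = Finset.univ.val.map f ∧ ∀ i : Fin (2 * m),
      ((i : ℕ) < h → f i ∈ A) ∧ (h ≤ (i : ℕ) → (i : ℕ) < 2 * m - h → f i ∈ B) ∧
      (2 * m - h ≤ (i : ℕ) → f i ∈ D) := by
  have hlA : A.toList.length = h := by rw [Multiset.length_toList, hA]
  have hlB : B.toList.length = 2 * m - 2 * h := by rw [Multiset.length_toList, hB]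
  have hlD : D.toList.length = h := by rw [Multiset.length_toList, hD]
  set l := A.toList ++ B.toList ++ D.toList with hl
  have hlen : l.length = 2 * m := by
    rw [hl, List.length_append, List.length_append, hlA, hlB, hlD]
    omega
  refine ⟨fun i => l[(i : ℕ)]'(by rw [hlen]; exact i.2), ?_, fun i => ⟨?_, ?_, ?_⟩⟩
  · rw [Fin.univ_val_map]
    have h1 : List.ofFn (fun i : Fin (2 * m) => l[(i : ℕ)]'(by rw [hlen]; exact i.2)) = l := by
      refine List.ext_getElem (by simp [hlen]) fun n h1 h2 => by simp
    rw [h1, hl, ← Multiset.coe_add, ← Multiset.coe_add, Multiset.coe_toList, Multiset.coe_toList,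
      Multiset.coe_toList]
  · intro hi
    rw [← Multiset.mem_toList]
    simp only [hl]
    rw [List.getElem_append_left (by rw [List.length_append]; omega),
      List.getElem_append_left (by omega)]
    exact List.getElem_mem _
  · intro hi hi'
    rw [← Multiset.mem_toList]
    simp only [hl]
    rw [List.getElem_append_left (by rw [List.length_append]; omega),
      List.getElem_append_right (by omega)]
    exact List.getElem_mem _
  · intro hi
    rw [← Multiset.mem_toList]
    simp only [hl]
    rw [List.getElem_append_right (by rw [List.length_append]; omega)]
    exact List.getElem_mem _

theorem nu_lt_zero_iff {p q : ℕ} [Fact p.Prime] (hq : 1 < q) {x : PadicAlgCl p} (hx : x ≠ 0) :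
    nu p q x < 0 ↔ 1 < ‖x‖ := by
  have hq' : (1 : ℝ) < q := by exact_mod_cast hq
  rw [nu, if_neg hx, ← WithTop.coe_zero, WithTop.coe_lt_coe, neg_lt_zero,
    Real.logb_pos_iff hq' (norm_pos_iff.2 hx)]

namespace IsAdmissible

variable {p h a : ℕ} [Fact p.Prime] {w : ℚ} {G : ℤ[X]}

theorem map_aroots (ι : Qbar →+* PadicAlgCl p) :
    ((perturbedCyclotomic w G).aroots Qbar).map ι =
      (perturbedCyclotomic w G).aroots (PadicAlgCl p) := by
  rw [aroots_def, aroots_def, ← (IsAlgClosed.splits _).roots_map, Polynomial.map_map,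
    Subsingleton.elim (ι.comp (algebraMap ℚ Qbar)) (algebraMap ℚ (PadicAlgCl p))]

theorem aeval_map_root (ι : Qbar →+* PadicAlgCl p) {β : Qbar}
    (hβ : aeval β (perturbedCyclotomic w G) = 0) : aeval (ι β) (perturbedCyclotomic w G) = 0 := by
  have h1 := congrArg ι hβ
  rw [aeval_def, hom_eval₂, map_zero,
    Subsingleton.elim (ι.comp (algebraMap ℚ Qbar)) (algebraMap ℚ (PadicAlgCl p))] at h1
  exact h1

theorem one_lt_q (H : IsAdmissible p h a w G) : 1 < p ^ a := by exact_mod_cast H.one_lt_pow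

theorem nu_of_one_lt (H : IsAdmissible p h a w G)
    {x : PadicAlgCl p} (hx : aeval x (perturbedCyclotomic w G) = 0)
    (h1 : 1 < ‖x‖) : nu p (p ^ a) x = ((-1 / h : ℝ) : WithTop ℝ) := by
  have hx0 : x ≠ 0 := ne_zero_of_aeval_perturbedCyclotomic hx
  have hq : (1 : ℝ) < ((p ^ a : ℕ) : ℝ) := by exact_mod_cast H.one_lt_q
  have hh : (h : ℝ) ≠ 0 := by have := H.one_le_h; positivity
  have h2 : (h : ℝ) * Real.logb ((p ^ a : ℕ) : ℝ) ‖x‖ = 1 := by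
    rw [← Real.logb_pow, H.norm_pow_of_root h1 hx, Nat.cast_pow]
    rw [Nat.cast_pow] at hq
    exact Real.logb_self_eq_one hq
  rw [nu, if_neg hx0, WithTop.coe_inj]
  field_simp
  linarith

theorem nu_of_lt_one (H : IsAdmissible p h a w G)
    {x : PadicAlgCl p} (hx : aeval x (perturbedCyclotomic w G) = 0)
    (h1 : ‖x‖ < 1) : nu p (p ^ a) x = ((1 / h : ℝ) : WithTop ℝ) := by
  have hx0 : x ≠ 0 := ne_zero_of_aeval_perturbedCyclotomic hx
  have hq : (1 : ℝ) < ((p ^ a : ℕ) : ℝ) := by exact_mod_cast H.one_lt_q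
  have hh : (h : ℝ) ≠ 0 := by have := H.one_le_h; positivity
  have h2 : (h : ℝ) * Real.logb ((p ^ a : ℕ) : ℝ) ‖x‖⁻¹ = 1 := by
    rw [← Real.logb_pow, H.norm_pow_of_root_of_norm_lt_one h1 hx, Nat.cast_pow]
    rw [Nat.cast_pow] at hq
    exact Real.logb_self_eq_one hq
  rw [Real.logb_inv] at h2
  rw [nu, if_neg hx0, WithTop.coe_inj]
  field_simp
  linarith

theorem slopes (H : IsAdmissible p h a w G) (ι : Qbar →+* PadicAlgCl p) : ∃ α : Fin (2 * 10) → Qbar,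
    (perturbedCyclotomic w G).aroots Qbar = Finset.univ.val.map α ∧ ∀ i : Fin (2 * 10),
      ((i : ℕ) < h → nu p (p ^ a) (ι (α i)) = ((-1 / h : ℝ) : WithTop ℝ)) ∧
      (h ≤ (i : ℕ) → (i : ℕ) < 2 * 10 - h → nu p (p ^ a) (ι (α i)) = 0) ∧
      (2 * 10 - h ≤ (i : ℕ) → nu p (p ^ a) (ι (α i)) = ((1 / h : ℝ) : WithTop ℝ)) := by
  classical
  set M := (perturbedCyclotomic w G).aroots Qbar with hM
  have hM20 : M.card = 20 := card_aroots_perturbedCyclotomic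
  have hA : (M.filter fun r => 1 < ‖ι r‖).card = h := by
    have h1 := H.card_filter_one_lt_norm
    rwa [← map_aroots ι, Multiset.filter_map, Multiset.card_map] at h1
  have hD : (M.filter fun r => ‖ι r‖ < 1).card = h := by
    have h1 := H.card_filter_norm_lt_one
    rwa [← map_aroots ι, Multiset.filter_map, Multiset.card_map] at h1
  have hsplit : (M.filter fun r => 1 < ‖ι r‖) + (M.filter fun r => ‖ι r‖ = 1) +
      (M.filter fun r => ‖ι r‖ < 1) = M := by
    have h1 := Multiset.filter_add_not (fun r => 1 < ‖ι r‖) M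
    have h2 := Multiset.filter_add_not (fun r => ‖ι r‖ = 1) (M.filter fun r => ¬ 1 < ‖ι r‖)
    rw [Multiset.filter_filter, Multiset.filter_filter] at h2
    rw [← h2] at h1
    conv_rhs => rw [← h1]
    rw [add_assoc]
    congr 2
    · exact Multiset.filter_congr fun r _ => ⟨fun h => ⟨h, h.le.not_gt⟩, fun h => h.1⟩
    · exact Multiset.filter_congr fun r _ =>
        ⟨fun h => ⟨h.ne, h.not_gt⟩, fun h => lt_of_le_of_ne (not_lt.1 h.2) h.1⟩
  have hh10 : h ≤ 10 := by have := H.natDegree_add; omega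
  have hB : (M.filter fun r => ‖ι r‖ = 1).card = 2 * 10 - 2 * h := by
    have h1 := congrArg Multiset.card hsplit
    rw [Multiset.card_add, Multiset.card_add, hA, hD, hM20] at h1
    omega
  obtain ⟨α, hα, hα'⟩ := Multiset.exists_fin_enumeration _ _ _ hh10 hA hB hD
  rw [hsplit] at hα
  refine ⟨α, hα, fun i => ⟨fun hi => ?_, fun hi hi' => ?_, fun hi => ?_⟩⟩
  · obtain ⟨h1, h2⟩ := Multiset.mem_filter.1 ((hα' i).1 hi)
    exact H.nu_of_one_lt (aeval_map_root ι (aeval_eq_zero_of_mem h1)) h2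
  · obtain ⟨h1, h2⟩ := Multiset.mem_filter.1 ((hα' i).2.1 hi hi')
    have h3 : ι (α i) ≠ 0 :=
      ne_zero_of_aeval_perturbedCyclotomic (aeval_map_root ι (aeval_eq_zero_of_mem h1))
    rw [nu, if_neg h3, h2, Real.logb_one, neg_zero, WithTop.coe_zero]
  · obtain ⟨h1, h2⟩ := Multiset.mem_filter.1 ((hα' i).2.2 hi)
    exact H.nu_of_lt_one (aeval_map_root ι (aeval_eq_zero_of_mem h1)) h2

theorem negPart_descends (H : IsAdmissible p h a w G) (ι : Qbar →+* PadicAlgCl p) : ∃ P : ℚ_[p][X],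
    P.map (algebraMap ℚ_[p] (PadicAlgCl p)) = negPart p ι (p ^ a) (perturbedCyclotomic w G) ∧
      Irreducible P := by
  classical
  obtain ⟨s, hs, hs1⟩ := H.exists_root_one_lt
  have hs0 : s ≠ 0 := ne_zero_of_aeval_perturbedCyclotomic hs
  -- `negPart` runs over inverses of roots, so negative valuation there selects the roots of norm
  -- below one; their minimal polynomial is rescaled to constant term one.
  set r := s⁻¹ with hr
  have hr0 : r ≠ 0 := inv_ne_zero hs0
  have hrroot : aeval r (perturbedCyclotomic w G) = 0 := by
    rw [← aeval_inv_perturbedCyclotomic H.natDegree_lt hs0] at hs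
    exact (mul_eq_zero.1 hs).resolve_right (pow_ne_zero _ hs0)
  have hr1 : ‖r‖ < 1 := by
    rw [hr, norm_inv]
    exact inv_lt_one_of_one_lt₀ hs1
  have hint : IsIntegral ℚ_[p] r := Algebra.IsIntegral.isIntegral r
  have hc0 : (minpoly ℚ_[p] r).coeff 0 ≠ 0 := minpoly.coeff_zero_ne_zero hint hr0
  refine ⟨C ((minpoly ℚ_[p] r).coeff 0)⁻¹ * minpoly ℚ_[p] r, ?_, ?_⟩
  · have h1 := ((minpoly.monic hint).map
      (algebraMap ℚ_[p] (PadicAlgCl p))).eq_C_coeff_zero_mul_prod_one_sub (IsAlgClosed.splits _)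
      (by rw [coeff_map]; simpa using hc0)
    rw [Polynomial.map_mul, h1, ← aroots_def, H.aroots_minpoly_of_lt_one hrroot hr1, map_C,
      ← mul_assoc, ← C_mul, coeff_map, ← map_mul, inv_mul_cancel₀ hc0, map_one, C_1, one_mul,
      ← map_aroots ι, Multiset.filter_map, Multiset.map_map]
    unfold _root_.negPart inverseRoots
    rw [Multiset.filter_map, Multiset.map_map]
    have hfil : (((perturbedCyclotomic w G).aroots Qbar).filter
        ((fun β => nu p (p ^ a) (ι β) < 0) ∘ fun r => r⁻¹)) =
        ((perturbedCyclotomic w G).aroots Qbar).filter ((fun s => ‖s‖ < 1) ∘ ι) := by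
      refine Multiset.filter_congr fun β hβ => ?_
      have hβ0 : ι β ≠ 0 :=
        ne_zero_of_aeval_perturbedCyclotomic (aeval_map_root ι (aeval_eq_zero_of_mem hβ))
      simp only [Function.comp_apply, map_inv₀]
      rw [nu_lt_zero_iff H.one_lt_q (inv_ne_zero hβ0), norm_inv,
        one_lt_inv₀ (norm_pos_iff.2 hβ0)]
    rw [hfil]
    simp only [Function.comp_def, map_inv₀]
  · exact (irreducible_isUnit_mul (isUnit_C.2 (inv_ne_zero hc0).isUnit)).2
      (minpoly.irreducible hint)

theorem map_mem_lifts (H : IsAdmissible p h a w G) (l : ℕ) [Fact l.Prime] (hl : l ≠ p) :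
    (perturbedCyclotomic w G).map (algebraMap ℚ ℚ_[l]) ∈
      Polynomial.lifts (algebraMap ℤ_[l] ℚ_[l]) := by
  have hw : ‖(w : ℚ_[l])‖ ≤ 1 := by
    obtain ⟨u, hu⟩ := H.denominator
    have h1 : (w : ℚ_[l]) * (p : ℚ_[l]) ^ a = u := by exact_mod_cast congrArg (Rat.cast) hu
    have h2 := congrArg norm h1
    have hp : ‖(p : ℚ_[l])‖ = 1 := by
      rw [Padic.norm_natCast_eq_one_iff]
      exact (Nat.coprime_primes Fact.out Fact.out).2 hl
    rw [norm_mul, norm_pow, hp, one_pow, mul_one] at h2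
    rw [h2]
    exact Padic.norm_int_le_one u
  have hX := X_mem_lifts (algebraMap ℤ_[l] ℚ_[l])
  have hC : C (algebraMap ℚ ℚ_[l] w) ∈ Polynomial.lifts (algebraMap ℤ_[l] ℚ_[l]) :=
    C'_mem_lifts ⟨⟨w, hw⟩, (eq_ratCast (algebraMap ℚ ℚ_[l]) w).symm⟩
  have hR : ((reciprocalLift G).map (Int.castRingHom ℚ)).map (algebraMap ℚ ℚ_[l]) ∈
      Polynomial.lifts (algebraMap ℤ_[l] ℚ_[l]) := by
    refine (mem_lifts _).2 ⟨(reciprocalLift G).map (Int.castRingHom ℤ_[l]), ?_⟩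
    rw [Polynomial.map_map, Polynomial.map_map]
    congr 1
  have hsub : ∀ f g : ℚ_[l][X], f ∈ Polynomial.lifts (algebraMap ℤ_[l] ℚ_[l]) →
      g ∈ Polynomial.lifts (algebraMap ℤ_[l] ℚ_[l]) →
      f - g ∈ Polynomial.lifts (algebraMap ℤ_[l] ℚ_[l]) := by
    intro f g hf hg
    obtain ⟨f', rfl⟩ := (mem_lifts _).1 hf
    obtain ⟨g', rfl⟩ := (mem_lifts _).1 hg
    exact (mem_lifts _).2 ⟨f' - g', Polynomial.map_sub _⟩
  simp only [perturbedCyclotomic, Polynomial.map_add, Polynomial.map_sub, Polynomial.map_pow, map_X,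
    Polynomial.map_one, Polynomial.map_mul, map_C]
  exact add_mem (add_mem (hsub _ _ (pow_mem hX _) (pow_mem hX _)) (one_mem _)) (mul_mem hC hR)

theorem satisfiesCondition (H : IsAdmissible p h a w G) (ι : Qbar →+* PadicAlgCl p) :
    SatisfiesCondition p ι (p ^ a) 10 h 1 (perturbedCyclotomic w G) where
  q_eq_pow := ⟨a, H.one_le_a, rfl⟩
  coeff_zero := coeff_zero_perturbedCyclotomic w G
  natDegree_eq := natDegree_perturbedCyclotomic w G
  norm_root _ hz := H.norm_eq_one_of_root hz
  not_rootOfUnity _ hz _ hn := H.pow_ne_one_of_root hz hn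
  integral l _ hl := H.map_mem_lifts l hl
  one_le_h := H.one_le_h
  h_le_m := by have := H.natDegree_add; omega
  slopes := H.slopes ι
  one_le_e := le_rfl
  power := ⟨perturbedCyclotomic w G, H.irreducible, coeff_zero_perturbedCyclotomic w G,
    (pow_one _).symm, H.negPart_descends ι⟩

theorem isSquare_eval (H : IsAdmissible p h a w G) : IsSquare
    ((perturbedCyclotomic w G).eval 1 * (perturbedCyclotomic w G).eval (-1)) := by
  have h1 := aeval_perturbedCyclotomic (w := w) H.natDegree_lt (one_ne_zero (α := ℚ))
  have h2 := aeval_perturbedCyclotomic (w := w) H.natDegree_lt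
    (neg_ne_zero.2 (one_ne_zero (α := ℚ)))
  rw [coe_aeval_eq_eval] at h1 h2
  rw [show (1 : ℚ) + 1⁻¹ = 2 by norm_num] at h1
  rw [show (-1 : ℚ) + (-1)⁻¹ = -2 by norm_num] at h2
  convert H.isSquare using 2
  · rw [h1, eq_ratCast, Rat.cast_id]
    ring
  · rw [h2, eq_ratCast, Rat.cast_id]
    ring

theorem isSquare_discr (H : IsAdmissible p h a w G)
    {γ : Qbar} (hγ : aeval γ (perturbedCyclotomic w G) = 0) :
    IsSquare (NumberField.discr ℚ⟮γ⟯) := by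
  refine isSquare_discr_of_reflect (adjoin.powerBasis (isIntegral_of_root hγ))
    (L := perturbedCyclotomic w G) ?_ (natDegree_perturbedCyclotomic w G)
    (reflect_perturbedCyclotomic H.natDegree_lt) H.isSquare_eval
  rw [adjoin.powerBasis_gen]
  exact (minpoly_gen ℚ γ).trans (H.minpoly_of_root hγ)

theorem exists_polynomial (H : IsAdmissible p h a w G) (ι : Qbar →+* PadicAlgCl p) :
    ∃ (L : ℚ[X]) (γ : Fin 20 → Qbar) (q e : ℕ),
      L.map (algebraMap ℚ Qbar) = ∏ i, (1 - C (γ i) * X) ∧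
      SatisfiesCondition p ι q 10 h e L ∧
      (IsSquare (NumberField.discr ℚ⟮γ 0⟯) ∨ Even e) := by
  obtain ⟨α, hα, -⟩ := H.slopes ι
  have hroot (i : Fin (2 * 10)) : aeval (α i) (perturbedCyclotomic w G) = 0 := by
    refine aeval_eq_zero_of_mem ?_
    rw [hα]
    exact Multiset.mem_map_of_mem _ (Finset.mem_univ_val i)
  refine ⟨perturbedCyclotomic w G, fun i => (α i)⁻¹, p ^ a, 1, ?_, H.satisfiesCondition ι,
    Or.inl (H.isSquare_discr ?_)⟩
  · have hc : ((perturbedCyclotomic w G).map (algebraMap ℚ Qbar)).coeff 0 = 1 := by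
      rw [coeff_map, coeff_zero_perturbedCyclotomic, map_one]
    have h1 := ((monic_perturbedCyclotomic w G).map
      (algebraMap ℚ Qbar)).eq_C_coeff_zero_mul_prod_one_sub (IsAlgClosed.splits _)
      (by rw [hc]; exact one_ne_zero)
    rw [hc, C_1, one_mul, ← aroots_def, hα, Multiset.map_map] at h1
    exact h1
  -- Self-reciprocity makes the inverse root `γ 0` itself a root.
  · have h0 := hroot 0
    have hne : α 0 ≠ 0 := ne_zero_of_aeval_perturbedCyclotomic h0
    rw [← aeval_inv_perturbedCyclotomic H.natDegree_lt hne] at h0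
    exact (mul_eq_zero.1 h0).resolve_right (pow_ne_zero _ hne)

end IsAdmissible

/-! ### Choices of `w` and `G` -/

section constructions

variable (p : ℕ) [Fact p.Prime]

theorem two_pow_le_prime_pow (n : ℕ) : (2 : ℝ) ^ n ≤ (p : ℝ) ^ n := by
  have : (2 : ℝ) ≤ p := by exact_mod_cast (Fact.out : p.Prime).two_le
  gcongr

theorem padic_norm_inv_pow (n : ℕ) : ‖((((p : ℚ) ^ n)⁻¹ : ℚ) : ℚ_[p])‖ = (p : ℝ) ^ n := by
  push_cast
  rw [norm_inv, Padic.norm_p_pow, zpow_neg, inv_inv, zpow_natCast]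

/-- The exponent `11` is prime to `10`. Constant `G` takes equal values at `2` and `-2`, so the
product is a square. -/
theorem isAdmissible_ten : IsAdmissible p 10 11 ((p : ℚ) ^ 11)⁻¹ 1 where
  monic := monic_one
  natDegree_add := by simp
  one_le_h := by norm_num
  one_le_a := by norm_num
  coprime := by norm_num
  norm_w := padic_norm_inv_pow p 11
  denominator := by
    have : (p : ℚ) ≠ 0 := by exact_mod_cast (Fact.out : p.Prime).ne_zero
    exact ⟨1, by field_simp; simp⟩
  bound x _ := by
    have h1 := two_pow_le_prime_pow p 11
    rw [eval₂_one, mul_one, abs_of_nonneg (by positivity)]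
    push_cast
    exact inv_lt_one_of_one_lt₀ (by linarith)
  no_common_root z _ h0 := by simp at h0
  isSquare := ⟨1 + ((p : ℚ) ^ 11)⁻¹, by simp⟩

/-- A linear `G` cannot vanish at both `2` and `-2`. With `G(-2) = 0` one needs `1 + 4w` to be a
square: for `P = p^11` and `w = (P + 1) / P^2` it is `((P + 2) / P)^2`. The exponent becomes `22`,
still prime to `9`. -/
theorem isAdmissible_nine :
    IsAdmissible p 9 22 (((p : ℚ) ^ 11 + 1) * ((p : ℚ) ^ 22)⁻¹) (X + C 2) where
  monic := monic_X_add_C 2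
  natDegree_add := by rw [natDegree_X_add_C]
  one_le_h := by norm_num
  one_le_a := by norm_num
  coprime := by norm_num
  norm_w := by
    have h1 : ‖((p ^ 11 + 1 : ℕ) : ℚ_[p])‖ = 1 := by
      rw [Padic.norm_natCast_eq_one_iff]
      rw [pow_succ']
      simp
    have h2 := padic_norm_inv_pow p 22
    rw [Rat.cast_mul, norm_mul, h2]
    push_cast at h1 ⊢
    rw [h1, one_mul]
  denominator := by
    have : (p : ℚ) ≠ 0 := by exact_mod_cast (Fact.out : p.Prime).ne_zero
    exact ⟨p ^ 11 + 1, by field_simp; push_cast; ring⟩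
  bound x hx := by
    have h1 := two_pow_le_prime_pow p 11
    obtain ⟨h2, h3⟩ := abs_le.1 hx
    have h4 : (X + C 2 : ℤ[X]).eval₂ (Int.castRingHom ℝ) x = x + 2 := by simp
    rw [h4, abs_of_nonneg (mul_nonneg (by positivity) (by linarith))]
    push_cast
    have hP : (0 : ℝ) < (p : ℝ) ^ 11 := by linarith
    rw [show (p : ℝ) ^ 22 = (p : ℝ) ^ 11 * (p : ℝ) ^ 11 by ring]
    generalize (p : ℝ) ^ 11 = P at *
    rw [mul_right_comm, mul_inv_lt_iff₀ (by positivity), one_mul]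
    nlinarith
  no_common_root z hz h0 := by
    have h1 : z + z⁻¹ + 2 = 0 := by simpa using h0
    have h2 : (z + 1) ^ 2 = 0 := by
      field_simp at h1
      linear_combination h1
    have h3 : z = -1 := eq_neg_of_add_eq_zero_left (pow_eq_zero_iff (two_ne_zero) |>.1 h2)
    rw [h3]
    norm_num
  isSquare := by
    have : (p : ℚ) ≠ 0 := by exact_mod_cast (Fact.out : p.Prime).ne_zero
    refine ⟨((p : ℚ) ^ 11 + 2) / (p : ℚ) ^ 11, ?_⟩
    simp only [eval₂_add, eval₂_X, eval₂_C]
    norm_num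
    field_simp
    ring

/-- The factor `X^2 - 4` kills the perturbation at `2` and `-2`, so `L(1) = L(-1) = 1`. The exponent
`11` is prime to every `h ≤ 8`, and `2^11` exceeds the bound `4 * 2^8` for `|G|` on `[-2, 2]`. -/
theorem isAdmissible_of_le_eight {h : ℕ} (h1 : 1 ≤ h) (h8 : h ≤ 8) :
    IsAdmissible p h 11 ((p : ℚ) ^ 11)⁻¹ ((X ^ 2 - C 4) * X ^ (8 - h)) where
  monic := (monic_X_pow_sub_C 4 two_ne_zero).mul (monic_X_pow _)
  natDegree_add := by
    rw [(monic_X_pow_sub_C (4 : ℤ) two_ne_zero).natDegree_mul (monic_X_pow _),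
      natDegree_X_pow_sub_C, natDegree_X_pow]
    omega
  one_le_h := h1
  one_le_a := by norm_num
  coprime := by
    interval_cases h <;> norm_num
  norm_w := padic_norm_inv_pow p 11
  denominator := by
    have : (p : ℚ) ≠ 0 := by exact_mod_cast (Fact.out : p.Prime).ne_zero
    exact ⟨1, by field_simp; simp⟩
  bound x hx := by
    have h1 := two_pow_le_prime_pow p 11
    have h2 : ((X ^ 2 - C 4) * X ^ (8 - h) : ℤ[X]).eval₂ (Int.castRingHom ℝ) x =
        (x ^ 2 - 4) * x ^ (8 - h) := by simp [eval₂_mul, eval₂_sub]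
    have h3 : |x ^ 2 - 4| ≤ 4 := by
      obtain ⟨h4, h5⟩ := abs_le.1 hx
      rw [abs_le]
      constructor <;> nlinarith
    have h4 : |x ^ (8 - h)| ≤ 2 ^ 8 := by
      rw [abs_pow]
      calc |x| ^ (8 - h) ≤ 2 ^ (8 - h) := by gcongr
        _ ≤ 2 ^ 8 := pow_le_pow_right₀ (by norm_num) (by omega)
    have h5 : |(x ^ 2 - 4) * x ^ (8 - h)| ≤ 4 * 2 ^ 8 := by
      rw [abs_mul]
      gcongr
    have hP : (0 : ℝ) < (p : ℝ) ^ 11 := by linarith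
    rw [h2, abs_mul, abs_of_nonneg (a := ((((p : ℚ) ^ 11)⁻¹ : ℚ) : ℝ)) (by positivity)]
    push_cast
    rw [inv_mul_lt_iff₀ hP, mul_one]
    linarith
  no_common_root z hz h0 := by
    have h2 : ((z + z⁻¹) ^ 2 - 4) * (z + z⁻¹) ^ (8 - h) = 0 := by
      simpa [eval₂_mul, eval₂_sub] using h0
    rcases mul_eq_zero.1 h2 with h3 | h3
    · have h4 : (z ^ 2 - 1) ^ 2 = 0 := by
        field_simp at h3
        linear_combination h3
      have h5 : z ^ 2 = 1 := sub_eq_zero.1 (pow_eq_zero_iff two_ne_zero |>.1 h4)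
      have h6 : z ^ 20 - z ^ 10 + 1 = (z ^ 2) ^ 10 - (z ^ 2) ^ 5 + 1 := by ring
      rw [h6, h5]
      norm_num
    · have h4 := eq_zero_of_pow_eq_zero h3
      have h5 : z ^ 2 = -1 := by
        field_simp at h4
        linear_combination h4
      have h6 : z ^ 20 - z ^ 10 + 1 = (z ^ 2) ^ 10 - (z ^ 2) ^ 5 + 1 := by ring
      rw [h6, h5]
      norm_num
  isSquare := by
    refine ⟨1, ?_⟩
    simp only [eval₂_mul, eval₂_sub, eval₂_pow, eval₂_X, eval₂_C]
    norm_num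

end constructions

end

theorem lemma5p2 (p : ℕ) [Fact p.Prime] (ι : Qbar →+* PadicAlgCl p)
    (h' : ℕ) (h1 : 1 ≤ h') (h10 : h' ≤ 10) :
    ∃ (L : ℚ[X]) (γ : Fin 20 → Qbar) (q e : ℕ),
      L.map (algebraMap ℚ Qbar) = ∏ i, (1 - C (γ i) * X) ∧
      SatisfiesCondition p ι q 10 h' e L ∧
      (IsSquare (NumberField.discr ℚ⟮γ 0⟯) ∨ Even e) := by
  rcases Nat.lt_or_ge 8 h' with h8 | h8
  · obtain rfl | rfl : h' = 9 ∨ h' = 10 := by omega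
    · exact (isAdmissible_nine p).exists_polynomial ι
    · exact (isAdmissible_ten p).exists_polynomial ι
  · exact (isAdmissible_of_le_eight p h1 h8).exists_polynomial ι
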